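/- **Setting.** Let $\Sigma=[-1,1]^2$, $2\Sigma=[-2,2]^2$. For $M\in\mathbb N$, let $\mathrm{Hyp}^M$ be the class of all $\phi\in C^M(2\Sigma,\mathbb R)$ with $\phi(0)=0$, $\nabla\phi(0)=0$, $D^2\phi(0)=\begin{pmatrix}0&1\\1&0\end{pmatrix}$ and $\|\partial_x^\alpha\partial_y^\beta\phi\|_{L^\infty(2\Sigma)}\le 10^{-5}$ whenever $3\le\alpha+\beta\le M$. For such $\phi$ (with $M\ge 3$) put $H=\phi_{xy}^2-\phi_{xx}\phi_{yy}$, $$A=\frac{\phi_{yy}}{\phi_{xy}+\sqrt H},\qquad B=\frac{\phi_{xx}}{\phi_{xy}+\sqrt H},$$ $$t^1_z(z_1,z_2)=\phi_x(z_2)-\phi_x(z_1)-B(z)\big(\phi_y(z_2)-\phi_y(z_1)\big),\quad t^2_z(z_1,z_2)=\phi_y(z_2)-\phi_y(z_1)-A(z)\big(\phi_x(z_2)-\phi_x(z_1)\big).$$ **Caps.** Let $K\ge1$ and $\mu\ge 1$ be real. A cap with centre $c\in\mathbb R^2$ is the intersection $\tau\neq\emptyset$ with $\Sigma$ of the closed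 axis-parallel square of centre $c$ and side length $\mu^{1/2}K^{-1}$. Two caps with centres $c_1\ne c_2$ are strongly separated if $$\max\big\{\min\{|t^1_{c_1}(c_1,c_2)|,|t^2_{c_1}(c_1,c_2)|\},\ \min\{|t^1_{c_2}(c_1,c_2)|,|t^2_{c_2}(c_1,c_2)|\}\big\}\ge 50\,\mu^{1/2}K^{-1}.$$ **The family $\mathcal L$.** Let $C,C',C_3>0$ be constants, $\varepsilon'>0$, and put $s=\mu^{1/2}K^{-3/4}$. * $\mathcal L_1$: Fix $a_0\in\mathbb R$, let $A_k=a_0+kCs$ ($k\in\mathbb Z$) and $R^k_{II}=\{z\in\Sigma:|A(z)-A_k|<Cs\}$. Let $\tilde\omega_k$ be the unit vector in the direction $(-A_k,1)$ and $\tilde\omega_k^\perp$ the one in the direction $(1,A_k)$. For $j\in\mathbb Z$ let $S_{k,j}=[(j-1)C's,(j+1)C's]\,\tilde\omega_k^\perp+\mathbb R\tilde\omega_k$, $S^0_{k,j}=\{z\in S_{k,j}:(z+\mathbb R\tilde\omega_k^\perp)\cap S_{k,j}\cap R^k_{II}\neq\emptyset\}$ and $S^1_{k,j}=S^0_{k,j}+[-s,s]\tilde\omega_k$.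 The connected components of $S^1_{k,j}$ are rectangles. Divide each of them, of length $\ell$ say, by cuts orthogonal to $\tilde\omega_k$, into the least possible number $\lceil 2\ell K^{\varepsilon'}\rceil$ of rectangles $\tilde L$ of lengths at least $s$ and at most $\frac12K^{-\varepsilon'}$. Then $\mathcal L_1$ is the set of all $L=\tilde L+[-s,s]\tilde\omega_k$ (over all $k$, $j$, components and $\tilde L$). * $\mathcal L_2$: the analogous family obtained by interchanging the two coordinates, so that $A$ is replaced by $B$ (with its own $a_0$ and divisions). * $\mathcal L_3$: all closed axis-parallel squares of side length $d=C_3\mu^{1/2}K^{-1/4}$ which meet $\Sigma$ and have their centres on a grid $c_0+\frac d2\mathbb Z^2$, for some fixed $c_0\in\mathbb R^2$. Put $\mathcal L=\mathcal L_1\cup\mathcal L_2\cup\mathcal L_3$. **Lemma (The Geometric Lemma).** The following holds for all sufficiently large absolute constants $C,C',C_3$ (that is: there is $C_0$ such that for all $C,C_3\ge C_0$ there is $C_0'$ such that for all $C'\ge C_0'$ the following holds). Let $\bar N\ge 1$ be an integer, let $0<\varepsilon<10^{-10}$, and let $\varepsilon'$ be given by $10\bar N\varepsilon'=\varepsilon^8$.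 Then there is a constant $K_1\ge 1$, depending only on $\varepsilon$ (and on the fixed constants $C,C',C_3,\bar N$), such that the following is true for every $M\in\mathbb N$ with $\frac{3}{4M}\le\varepsilon'\le\frac3{2M}$, every real $K\ge K_1$, every $\mu$ with $1\le\mu\le K^{\varepsilon/2}$, every $\phi\in\mathrm{Hyp}^{M}$ and every family $\mathcal L$ constructed as above (for any choice of the offsets $a_0$, $c_0$ and of the divisions): if $\mathcal F$ is any family of caps of side length $\mu^{1/2}K^{-1}$ which does not contain two strongly separated caps, then there is a subcollection $\mathcal L_0\subset\mathcal L$ of cardinality $|\mathcal L_0|\le K^{3\varepsilon'}$ such that each cap in $\mathcal F$ is contained in at least one element of $\mathcal L_0$. -/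

import Mathlib

open Set

noncomputable section

namespace HypSurface

/-- The square `Σ = [-1,1] × [-1,1]`. -/
def sq : Set (ℝ × ℝ) := Icc (-1) 1 ×ˢ Icc (-1) 1

/-- The doubled square `2Σ = [-2,2] × [-2,2]`. -/
def sq2 : Set (ℝ × ℝ) := Icc (-2) 2 ×ˢ Icc (-2) 2

/-- The partial derivative in the first variable. -/
def pdx (f : ℝ × ℝ → ℝ) (z : ℝ × ℝ) : ℝ := fderiv ℝ f z (1, 0)

/-- The partial derivative in the second variable. -/
def pdy (f : ℝ × ℝ → ℝ) (z : ℝ × ℝ) : ℝ := fderiv ℝ f z (0, 1)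

/-- The class `Hyp^M`: `φ` stands for the extension to `2Σ`, and its values outside `2Σ` play no
role. The sup norms over `2Σ` of the (continuous) derivatives are taken over the interior of `2Σ`,
where the derivatives are two-sided. -/
structure Hyp (M : ℕ) (φ : ℝ × ℝ → ℝ) : Prop where
  contDiffOn : ContDiffOn ℝ M φ sq2
  zero : φ 0 = 0
  grad_x : pdx φ 0 = 0
  grad_y : pdy φ 0 = 0
  hess_xx : pdx (pdx φ) 0 = 0
  hess_xy : pdx (pdy φ) 0 = 1
  hess_yx : pdy (pdx φ) 0 = 1
  hess_yy : pdy (pdy φ) 0 = 0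
  bound : ∀ α β : ℕ, 3 ≤ α + β → α + β ≤ M → ∀ z ∈ interior sq2,
    |(pdx^[α] (pdy^[β] φ)) z| ≤ (10 : ℝ)⁻¹ ^ 5

/-- `H = φ_xy ^ 2 - φ_xx φ_yy`. -/
def negHess (φ : ℝ × ℝ → ℝ) (z : ℝ × ℝ) : ℝ :=
  pdx (pdy φ) z ^ 2 - pdx (pdx φ) z * pdy (pdy φ) z

/-- `A = φ_yy / (φ_xy + √H)`; the vector `(-A(z), 1)` is a null vector of the Hessian at `z`. -/
def coefA (φ : ℝ × ℝ → ℝ) (z : ℝ × ℝ) : ℝ :=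
  pdy (pdy φ) z / (pdx (pdy φ) z + √(negHess φ z))

/-- `B = φ_xx / (φ_xy + √H)`; the vector `(1, -B(z))` is a null vector of the Hessian at `z`. -/
def coefB (φ : ℝ × ℝ → ℝ) (z : ℝ × ℝ) : ℝ :=
  pdx (pdx φ) z / (pdx (pdy φ) z + √(negHess φ z))

/-- `t¹_z(z₁, z₂)`. -/
def t1 (φ : ℝ × ℝ → ℝ) (z z₁ z₂ : ℝ × ℝ) : ℝ :=
  pdx φ z₂ - pdx φ z₁ - coefB φ z * (pdy φ z₂ - pdy φ z₁)

/-- `t²_z(z₁, z₂)`. -/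
def t2 (φ : ℝ × ℝ → ℝ) (z z₁ z₂ : ℝ × ℝ) : ℝ :=
  pdy φ z₂ - pdy φ z₁ - coefA φ z * (pdx φ z₂ - pdx φ z₁)

/-- The closed axis-parallel square with centre `c` and side length `r`. -/
def square (c : ℝ × ℝ) (r : ℝ) : Set (ℝ × ℝ) :=
  {z | |z.1 - c.1| ≤ r / 2 ∧ |z.2 - c.2| ≤ r / 2}

/-- The cap with centre `c` and side length `μ^{1/2} K⁻¹`, truncated to `Σ`. -/
def cap (K μ : ℝ) (c : ℝ × ℝ) : Set (ℝ × ℝ) := square c (√μ * K⁻¹) ∩ sq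

/-- Strong separation of the caps with centres `c₁` and `c₂`. -/
def StronglySeparated (φ : ℝ × ℝ → ℝ) (K μ : ℝ) (c₁ c₂ : ℝ × ℝ) : Prop :=
  c₁ ≠ c₂ ∧
    50 * (√μ * K⁻¹) ≤
      max (min |t1 φ c₁ c₁ c₂| |t2 φ c₁ c₁ c₂|) (min |t1 φ c₂ c₁ c₂| |t2 φ c₂ c₁ c₂|)

/-- The unit vector in the direction of `(-a, 1)`. -/
def dir (a : ℝ) : ℝ × ℝ := (√(1 + a ^ 2))⁻¹ • (-a, 1)

/-- The unit vector `(1, a) / √(1 + a²)`, orthogonal to `dir a`. -/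
def perp (a : ℝ) : ℝ × ℝ := (√(1 + a ^ 2))⁻¹ • (1, a)

/-- The coordinate `⟨z, dir a⟩` of `z` along `dir a`. -/
def coord (a : ℝ) (z : ℝ × ℝ) : ℝ := z.1 * (dir a).1 + z.2 * (dir a).2

/-- The region `{z ∈ Σ : |A(z) - a| < r}`. -/
def region (φ : ℝ × ℝ → ℝ) (a r : ℝ) : Set (ℝ × ℝ) := {z ∈ sq | |coefA φ z - a| < r}

/-- The strip `[(j-1)w, (j+1)w] (dir a)^⊥ + ℝ (dir a)`. -/
def strip (a w : ℝ) (j : ℤ) : Set (ℝ × ℝ) :=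
  {z | ∃ u ∈ Icc (((j : ℝ) - 1) * w) (((j : ℝ) + 1) * w), ∃ t : ℝ, z = u • perp a + t • dir a}

/-- `E + [-s, s] (dir a)`. -/
def elongate (a s : ℝ) (E : Set (ℝ × ℝ)) : Set (ℝ × ℝ) :=
  {z | ∃ p ∈ E, ∃ r ∈ Icc (-s) s, z = p + r • dir a}

/-- The part of the strip whose cross-sections meet the region `{|A - a| < r}` within the strip. -/
def strip0 (φ : ℝ × ℝ → ℝ) (a r w : ℝ) (j : ℤ) : Set (ℝ × ℝ) :=
  {z ∈ strip a w j | ∃ v : ℝ, z + v • perp a ∈ strip a w j ∩ region φ a r}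

/-- `strip0`, made longer by `s` at both ends of each of its components. -/
def strip1 (φ : ℝ × ℝ → ℝ) (a r w s : ℝ) (j : ℤ) : Set (ℝ × ℝ) :=
  elongate a s (strip0 φ a r w j)

/-- `P` is a division of the rectangle `E`, one of whose axes is `dir a`, by cuts orthogonal to
`dir a`, into rectangles of lengths between `s` and `b`. A rectangle is cut only if it is longer
than `b`, and no more often than the bound `b` on the lengths makes necessary. -/
def IsDivision (a s b : ℝ) (E : Set (ℝ × ℝ)) (P : Set (Set (ℝ × ℝ))) : Prop :=
  ∃ (n : ℕ) (t : ℕ → ℝ),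
    n = ⌈(sSup (coord a '' E) - sInf (coord a '' E)) / b⌉₊ ∧
    t 0 = sInf (coord a '' E) ∧ t n = sSup (coord a '' E) ∧
    (∀ i < n, s ≤ t (i + 1) - t i ∧ t (i + 1) - t i ≤ b) ∧
    P = {Q | ∃ i < n, Q = {z ∈ E | coord a z ∈ Icc (t i) (t (i + 1))}}

/-- `𝓛` is a family of strips adapted to `A`, with
* directions `(-A_k, 1)`, where `A_k = a₀ + k r` (`k ∈ ℤ`) is equidistant with distance `r`
  (values `A_k` at distance at least `r` from the range of `A` on `Σ` contribute no strip);
* strips `S_{k,j}` of width `2w`, the part of them that meets `{|A - A_k| < r}`, lengthened by `s`;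
* a division of every connected component of this part into rectangles of length between
  `s` and `b`, each of which is finally lengthened by `s` at both ends. -/
def IsStripFamily (φ : ℝ × ℝ → ℝ) (a₀ r w s b : ℝ) (𝓛 : Set (Set (ℝ × ℝ))) : Prop :=
  ∃ P : ℤ → ℤ → Set (ℝ × ℝ) → Set (Set (ℝ × ℝ)),
    (∀ k j : ℤ, ∀ z ∈ strip1 φ (a₀ + k * r) r w s j,
      IsDivision (a₀ + k * r) s b
        (connectedComponentIn (strip1 φ (a₀ + k * r) r w s j) z)
        (P k j (connectedComponentIn (strip1 φ (a₀ + k * r) r w s j) z))) ∧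
    𝓛 = {L | ∃ k j : ℤ, ∃ z ∈ strip1 φ (a₀ + k * r) r w s j,
      ∃ Q ∈ P k j (connectedComponentIn (strip1 φ (a₀ + k * r) r w s j) z),
        L = elongate (a₀ + k * r) s Q}

/-- The squares of side length `d` that meet `Σ` and have their centres on the grid
`c₀ + (d/2) ℤ²`. -/
def largeCaps (c₀ : ℝ × ℝ) (d : ℝ) : Set (Set (ℝ × ℝ)) :=
  {L | (L ∩ sq).Nonempty ∧
    ∃ m n : ℤ, L = square (c₀.1 + m * (d / 2), c₀.2 + n * (d / 2)) d}

/-- `𝓛 = 𝓛₁ ∪ 𝓛₂ ∪ 𝓛₃`, where `𝓛₁` consists of strips adapted to `A`, `𝓛₂` is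
obtained by the same construction with the two coordinates interchanged (so that `A` is replaced by
`B`), and `𝓛₃` consists of squares of side length `C₃ μ^{1/2} K^{-1/4}`. The strips have
directions `A_k` at distance `C μ^{1/2} K^{-3/4}`, width `2 C' μ^{1/2} K^{-3/4}`, and are
chopped to lengths between `μ^{1/2} K^{-3/4}` and `K^{-ε'} / 2` before their final lengthening. -/
def IsAdaptedFamily (φ : ℝ × ℝ → ℝ) (C C' C₃ ε' K μ : ℝ) (𝓛 : Set (Set (ℝ × ℝ))) : Prop :=
  ∃ (a₀ b₀ : ℝ) (c₀ : ℝ × ℝ) (𝓛₁ 𝓛₂ : Set (Set (ℝ × ℝ))),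
    IsStripFamily φ a₀ (C * (√μ * K ^ (-(3 / 4) : ℝ))) (C' * (√μ * K ^ (-(3 / 4) : ℝ)))
      (√μ * K ^ (-(3 / 4) : ℝ)) (K ^ (-ε') / 2) 𝓛₁ ∧
    IsStripFamily (φ ∘ Prod.swap) b₀ (C * (√μ * K ^ (-(3 / 4) : ℝ)))
      (C' * (√μ * K ^ (-(3 / 4) : ℝ))) (√μ * K ^ (-(3 / 4) : ℝ)) (K ^ (-ε') / 2) 𝓛₂ ∧
    𝓛 = 𝓛₁ ∪ (fun L => Prod.swap '' L) '' 𝓛₂ ∪ largeCaps c₀ (C₃ * (√μ * K ^ (-(1 / 4) : ℝ)))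

end HypSurface

end

noncomputable section

namespace HypSurface

/-! Write δ = √μ K⁻¹ for the side of a cap, s = √μ K^{-3/4}, and D = d/8, where d is the side of the
large squares. Up to a relative error 10⁻³, t¹ and t² measure the vertical and the horizontal
displacement of two centres, so they cannot both be O(δ) when the distance is much larger than δ.

If all centres lie within ℓ¹-distance D of one of them, a single square of 𝓛₃ contains all caps.
Otherwise two centres c₁, c₂ are further than D apart. Neither base point separates them, so the
same one of t¹, t² is below 50δ at both; by the symmetry x ↔ y let it be t². A triangle argument
(`Hyp.t2_of_far`) carries this over to every centre c and a base point p ∈ {c₁, c₂} at distance at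
least D/2 from c. At the pair (p, c) the difference t²_p − t²_c equals (A(c) − A(p))(φ_x(c) −
φ_x(p)), and the last factor is at least 2D/5 in modulus. Hence |A(c) − A(p)| is O(δ/D) and at most
s (`Hyp.coefA_sub_le`): this is the balance K^{-1/4} K^{-3/4} = K^{-1}. With a = A(p), every cap
therefore meets the O(δ)-neighbourhood of a level curve of φ_y − aφ_x, at a point where A is within
O(s) of a (`levelSet`).

It remains to cover such a set by few strips (`Hyp.levelSet_cover`). The derivative of φ_y − aφ_x
along (−a, 1) is the value of the Hessian form at that vector, comparable in modulus to A − a. Where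
it is O(s) on an interval, the level curve follows a line of direction (−a, 1), and at most three
elements of 𝓛₁ suffice. The number of intervals has to be controlled: on slabs of height h =
K^{-2ε'} the bounds on M derivatives, with h^{M-2} far below δ, allow the level curve
(`Hyp.exists_newton`) and the Hessian form along it to be replaced by polynomials of degree bounded
in terms of M, so that counting roots bounds the number of intervals (`Hyp.exists_label`). There are
O(K^{2ε'}) slabs. The spare K^{ε'} absorbs all constants, which is uniform in M because only
finitely many M satisfy M ≤ 3/(2ε'). -/

/-! ### Partial derivatives on the open square and their commutation -/

theorem interior_sq2 : interior sq2 = Ioo (-2) 2 ×ˢ Ioo (-2) 2 := by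
  rw [sq2, interior_prod_eq, interior_Icc]

theorem isOpen_U : IsOpen (interior sq2) := isOpen_interior

theorem convex_sq : Convex ℝ sq := (convex_Icc _ _).prod (convex_Icc _ _)

theorem convex_U : Convex ℝ (interior sq2) :=
  ((convex_Icc _ _).prod (convex_Icc _ _)).interior

theorem mem_U {z : ℝ × ℝ} : z ∈ interior sq2 ↔ |z.1| < 2 ∧ |z.2| < 2 := by
  rw [interior_sq2, mem_prod, mem_Ioo, mem_Ioo, abs_lt, abs_lt]

theorem mem_sq {z : ℝ × ℝ} : z ∈ sq ↔ |z.1| ≤ 1 ∧ |z.2| ≤ 1 := by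
  rw [sq, mem_prod, mem_Icc, mem_Icc, abs_le, abs_le]

theorem clm_apply_eq (L : ℝ × ℝ →L[ℝ] ℝ) (v : ℝ × ℝ) :
    L v = v.1 * L (1, 0) + v.2 * L (0, 1) := by
  have : v = v.1 • ((1, 0) : ℝ × ℝ) + v.2 • ((0, 1) : ℝ × ℝ) := by ext <;> simp
  conv_lhs => rw [this]
  rw [map_add, map_smul, map_smul, smul_eq_mul, smul_eq_mul]

theorem contDiffOn_pdx {n : ℕ} {f : ℝ × ℝ → ℝ} (hf : ContDiffOn ℝ (n + 1 : ℕ) f (interior sq2)) :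
    ContDiffOn ℝ n (pdx f) (interior sq2) :=
  (hf.fderiv_of_isOpen isOpen_U (m := n) (by norm_cast)).clm_apply contDiffOn_const

theorem contDiffOn_pdy {n : ℕ} {f : ℝ × ℝ → ℝ} (hf : ContDiffOn ℝ (n + 1 : ℕ) f (interior sq2)) :
    ContDiffOn ℝ n (pdy f) (interior sq2) :=
  (hf.fderiv_of_isOpen isOpen_U (m := n) (by norm_cast)).clm_apply contDiffOn_const

theorem contDiffOn_iterate_pdx {n k : ℕ} {f : ℝ × ℝ → ℝ}
    (hf : ContDiffOn ℝ (n + k : ℕ) f (interior sq2)) :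
    ContDiffOn ℝ n (pdx^[k] f) (interior sq2) := by
  induction k generalizing f with
  | zero => exact hf
  | succ k ih => exact ih (contDiffOn_pdx hf)

theorem contDiffOn_iterate_pdy {n k : ℕ} {f : ℝ × ℝ → ℝ}
    (hf : ContDiffOn ℝ (n + k : ℕ) f (interior sq2)) :
    ContDiffOn ℝ n (pdy^[k] f) (interior sq2) := by
  induction k generalizing f with
  | zero => exact hf
  | succ k ih => exact ih (contDiffOn_pdy hf)

theorem pdx_congr {f g : ℝ × ℝ → ℝ} (h : EqOn f g (interior sq2)) :
    EqOn (pdx f) (pdx g) (interior sq2) := fun z hz => by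
  simp only [pdx, (h.eventuallyEq_of_mem (isOpen_U.mem_nhds hz)).fderiv_eq]

theorem pdy_congr {f g : ℝ × ℝ → ℝ} (h : EqOn f g (interior sq2)) :
    EqOn (pdy f) (pdy g) (interior sq2) := fun z hz => by
  simp only [pdy, (h.eventuallyEq_of_mem (isOpen_U.mem_nhds hz)).fderiv_eq]

theorem iterate_pdx_congr {f g : ℝ × ℝ → ℝ} (h : EqOn f g (interior sq2)) (k : ℕ) :
    EqOn (pdx^[k] f) (pdx^[k] g) (interior sq2) := by
  induction k generalizing f g with
  | zero => exact h
  | succ k ih => exact ih (pdx_congr h)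

theorem differentiableAt_of_contDiffOn {n : ℕ} (hn : 1 ≤ n) {f : ℝ × ℝ → ℝ}
    (hf : ContDiffOn ℝ n f (interior sq2)) {z : ℝ × ℝ} (hz : z ∈ interior sq2) :
    DifferentiableAt ℝ f z :=
  (hf.contDiffAt (isOpen_U.mem_nhds hz)).differentiableAt (by
    exact_mod_cast (Nat.one_le_iff_ne_zero.mp hn))

theorem pdy_pdx_comm {n : ℕ} (hn : 2 ≤ n) {f : ℝ × ℝ → ℝ}
    (hf : ContDiffOn ℝ n f (interior sq2)) :
    EqOn (pdy (pdx f)) (pdx (pdy f)) (interior sq2) := by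
  intro z hz
  have hs : IsSymmSndFDerivAt ℝ f z :=
    (hf.contDiffAt (isOpen_U.mem_nhds hz)).isSymmSndFDerivAt (by
      simp only [minSmoothness_of_isRCLikeNormedField]; exact_mod_cast hn)
  obtain ⟨k, rfl⟩ := Nat.exists_eq_add_of_le' (show 1 ≤ n by omega)
  have hd : DifferentiableAt ℝ (fderiv ℝ f) z :=
    ((hf.fderiv_of_isOpen isOpen_U (m := k) (by norm_cast)).contDiffAt
      (isOpen_U.mem_nhds hz)).differentiableAt (by
        exact_mod_cast (show k ≠ 0 by omega))
  have key : ∀ v w : ℝ × ℝ,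
      fderiv ℝ (fun u => fderiv ℝ f u v) z w = fderiv ℝ (fderiv ℝ f) z w v := fun v w => by
    rw [fderiv_clm_apply hd (differentiableAt_const v)]
    simp
  show fderiv ℝ (fun u => fderiv ℝ f u (1, 0)) z (0, 1)
    = fderiv ℝ (fun u => fderiv ℝ f u (0, 1)) z (1, 0)
  rw [key, key]
  exact hs.eq _ _

theorem iterate_pdy_pdx_comm {k : ℕ} {f : ℝ × ℝ → ℝ}
    (hf : ContDiffOn ℝ (k + 1 : ℕ) f (interior sq2)) :
    EqOn (pdy^[k] (pdx f)) (pdx (pdy^[k] f)) (interior sq2) := by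
  induction k with
  | zero => exact fun z _ => rfl
  | succ k ih =>
    rw [Function.iterate_succ_apply', Function.iterate_succ_apply']
    have h1 := ih (hf.of_le (by exact_mod_cast Nat.le_succ _))
    have h2 : ContDiffOn ℝ (2 : ℕ) (pdy^[k] f) (interior sq2) :=
      contDiffOn_iterate_pdy (by rwa [show 2 + k = k + 1 + 1 by ring])
    exact (pdy_congr h1).trans (pdy_pdx_comm le_rfl h2)

theorem iterate_pdy_iterate_pdx_comm {k l : ℕ} {f : ℝ × ℝ → ℝ}
    (hf : ContDiffOn ℝ (k + l : ℕ) f (interior sq2)) :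
    EqOn (pdy^[k] (pdx^[l] f)) (pdx^[l] (pdy^[k] f)) (interior sq2) := by
  induction l generalizing f with
  | zero => exact fun z _ => rfl
  | succ l ih =>
    rw [Function.iterate_succ_apply, Function.iterate_succ_apply]
    have h1 := ih (contDiffOn_pdx hf)
    exact h1.trans (iterate_pdx_congr
      (iterate_pdy_pdx_comm (hf.of_le (by exact_mod_cast (by omega)))) l)

theorem pdx_comp_swap (f : ℝ × ℝ → ℝ) : pdx (f ∘ Prod.swap) = pdy f ∘ Prod.swap := by
  ext z
  have := ContinuousLinearEquiv.comp_right_fderiv (ContinuousLinearEquiv.prodComm ℝ ℝ ℝ)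
    (f := f) (x := z)
  simp only [pdx, pdy, Function.comp_apply]
  exact (congrArg (fun L => L ((1 : ℝ), (0 : ℝ))) this)

theorem pdy_comp_swap (f : ℝ × ℝ → ℝ) : pdy (f ∘ Prod.swap) = pdx f ∘ Prod.swap := by
  ext z
  have := ContinuousLinearEquiv.comp_right_fderiv (ContinuousLinearEquiv.prodComm ℝ ℝ ℝ)
    (f := f) (x := z)
  simp only [pdx, pdy, Function.comp_apply]
  exact (congrArg (fun L => L ((0 : ℝ), (1 : ℝ))) this)

theorem iterate_pdx_comp_swap (f : ℝ × ℝ → ℝ) (k : ℕ) :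
    pdx^[k] (f ∘ Prod.swap) = pdy^[k] f ∘ Prod.swap := by
  induction k generalizing f with
  | zero => rfl
  | succ k ih => rw [Function.iterate_succ_apply, pdx_comp_swap, ih]; rfl

theorem iterate_pdy_comp_swap (f : ℝ × ℝ → ℝ) (k : ℕ) :
    pdy^[k] (f ∘ Prod.swap) = pdx^[k] f ∘ Prod.swap := by
  induction k generalizing f with
  | zero => rfl
  | succ k ih => rw [Function.iterate_succ_apply, pdy_comp_swap, ih]; rfl

theorem swap_mem_U {z : ℝ × ℝ} (hz : z ∈ interior sq2) : z.swap ∈ interior sq2 := by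
  rw [mem_U] at *; exact hz.symm

/-! ### The class Hyp^M: symmetry and bounds for the second derivatives -/

variable {M : ℕ} {φ : ℝ × ℝ → ℝ}

theorem Hyp.contDiffOn_U (hφ : Hyp M φ) : ContDiffOn ℝ M φ (interior sq2) :=
  hφ.contDiffOn.mono interior_subset

/-- Interchanging the variables exchanges A with B and t² with t¹, so the covering argument is
needed only for strips adapted to A. The bounds survive because partial derivatives commute up to
order M. -/
theorem Hyp.swap (hφ : Hyp M φ) : Hyp M (φ ∘ Prod.swap) where
  contDiffOn := hφ.contDiffOn.comp
    (ContinuousLinearEquiv.prodComm ℝ ℝ ℝ).contDiff.contDiffOn fun z hz => hz.symm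
  zero := hφ.zero
  grad_x := by rw [pdx_comp_swap]; exact hφ.grad_y
  grad_y := by rw [pdy_comp_swap]; exact hφ.grad_x
  hess_xx := by rw [pdx_comp_swap, pdx_comp_swap]; exact hφ.hess_yy
  hess_xy := by rw [pdy_comp_swap, pdx_comp_swap]; exact hφ.hess_yx
  hess_yx := by rw [pdx_comp_swap, pdy_comp_swap]; exact hφ.hess_xy
  hess_yy := by rw [pdy_comp_swap, pdy_comp_swap]; exact hφ.hess_xx
  bound α β h3 hM z hz := by
    rw [iterate_pdy_comp_swap, iterate_pdx_comp_swap, Function.comp_apply,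
      iterate_pdy_iterate_pdx_comm (hφ.contDiffOn_U.of_le (by exact_mod_cast hM)) (swap_mem_U hz)]
    exact hφ.bound β α (by omega) (by omega) _ (swap_mem_U hz)

theorem exists_mem_segment_sub_eq {f : ℝ × ℝ → ℝ} (hf : ContDiffOn ℝ (1 : ℕ) f (interior sq2))
    {z z' : ℝ × ℝ} (hz : z ∈ interior sq2) (hz' : z' ∈ interior sq2) :
    ∃ ξ ∈ segment ℝ z z', ξ ∈ interior sq2 ∧
      f z' - f z = (z'.1 - z.1) * pdx f ξ + (z'.2 - z.2) * pdy f ξ := by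
  obtain ⟨ξ, hξ, h⟩ := domain_mvt (f := f) (f' := fderiv ℝ f) (s := interior sq2)
    (fun x hx => (differentiableAt_of_contDiffOn le_rfl hf hx).hasFDerivAt.hasFDerivWithinAt)
    convex_U hz hz'
  refine ⟨ξ, hξ, convex_U.segment_subset hz hz' hξ, ?_⟩
  rw [h, clm_apply_eq]; rfl

theorem abs_sub_le_of_partials {f : ℝ × ℝ → ℝ} (hf : ContDiffOn ℝ (1 : ℕ) f (interior sq2))
    {B : ℝ} (hx : ∀ z ∈ interior sq2, |pdx f z| ≤ B) (hy : ∀ z ∈ interior sq2, |pdy f z| ≤ B)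
    {z z' : ℝ × ℝ} (hz : z ∈ interior sq2) (hz' : z' ∈ interior sq2) :
    |f z' - f z| ≤ B * (|z'.1 - z.1| + |z'.2 - z.2|) := by
  obtain ⟨ξ, -, hξ, h⟩ := exists_mem_segment_sub_eq hf hz hz'
  rw [h]
  refine (abs_add_le _ _).trans ?_
  rw [abs_mul, abs_mul]
  nlinarith [hx ξ hξ, hy ξ hξ, abs_nonneg (z'.1 - z.1), abs_nonneg (z'.2 - z.2)]

namespace Hyp

theorem contDiffOn_xx (hφ : Hyp M φ) (hM : 10 ≤ M) :
    ContDiffOn ℝ (1 : ℕ) (pdx (pdx φ)) (interior sq2) :=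
  contDiffOn_pdx (contDiffOn_pdx (hφ.contDiffOn_U.of_le (by exact_mod_cast (by omega))))

theorem contDiffOn_xy (hφ : Hyp M φ) (hM : 10 ≤ M) :
    ContDiffOn ℝ (1 : ℕ) (pdx (pdy φ)) (interior sq2) :=
  contDiffOn_pdx (contDiffOn_pdy (hφ.contDiffOn_U.of_le (by exact_mod_cast (by omega))))

theorem contDiffOn_yy (hφ : Hyp M φ) (hM : 10 ≤ M) :
    ContDiffOn ℝ (1 : ℕ) (pdy (pdy φ)) (interior sq2) :=
  contDiffOn_pdy (contDiffOn_pdy (hφ.contDiffOn_U.of_le (by exact_mod_cast (by omega))))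

theorem pdy_pdx (hφ : Hyp M φ) (hM : 10 ≤ M) :
    EqOn (pdy (pdx φ)) (pdx (pdy φ)) (interior sq2) :=
  pdy_pdx_comm (n := 2) le_rfl (hφ.contDiffOn_U.of_le (by exact_mod_cast (by omega)))

theorem lip_xx (hφ : Hyp M φ) (hM : 10 ≤ M) {z z' : ℝ × ℝ} (hz : z ∈ interior sq2)
    (hz' : z' ∈ interior sq2) :
    |pdx (pdx φ) z' - pdx (pdx φ) z| ≤ 10⁻¹ ^ 5 * (|z'.1 - z.1| + |z'.2 - z.2|) := by
  refine abs_sub_le_of_partials (hφ.contDiffOn_xx hM) (fun w hw => ?_) (fun w hw => ?_) hz hz'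
  · exact hφ.bound 3 0 (by omega) (by omega) w hw
  · have := iterate_pdy_iterate_pdx_comm (k := 1) (l := 2) (f := φ)
      (hφ.contDiffOn_U.of_le (by exact_mod_cast (by omega))) hw
    simp only [Function.iterate_succ, Function.iterate_zero, Function.comp_apply, id] at this
    rw [this]
    exact hφ.bound 2 1 (by omega) (by omega) w hw

theorem lip_xy (hφ : Hyp M φ) (hM : 10 ≤ M) {z z' : ℝ × ℝ} (hz : z ∈ interior sq2)
    (hz' : z' ∈ interior sq2) :
    |pdx (pdy φ) z' - pdx (pdy φ) z| ≤ 10⁻¹ ^ 5 * (|z'.1 - z.1| + |z'.2 - z.2|) := by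
  refine abs_sub_le_of_partials (hφ.contDiffOn_xy hM) (fun w hw => ?_) (fun w hw => ?_) hz hz'
  · exact hφ.bound 2 1 (by omega) (by omega) w hw
  · have := iterate_pdy_iterate_pdx_comm (k := 1) (l := 1) (f := pdy φ)
      (contDiffOn_pdy (hφ.contDiffOn_U.of_le (by exact_mod_cast (by omega)))) hw
    simp only [Function.iterate_succ, Function.iterate_zero, Function.comp_apply, id] at this
    rw [this]
    exact hφ.bound 1 2 (by omega) (by omega) w hw

theorem lip_yy (hφ : Hyp M φ) (hM : 10 ≤ M) {z z' : ℝ × ℝ} (hz : z ∈ interior sq2)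
    (hz' : z' ∈ interior sq2) :
    |pdy (pdy φ) z' - pdy (pdy φ) z| ≤ 10⁻¹ ^ 5 * (|z'.1 - z.1| + |z'.2 - z.2|) := by
  refine abs_sub_le_of_partials (hφ.contDiffOn_yy hM) (fun w hw => ?_) (fun w hw => ?_) hz hz'
  · exact hφ.bound 1 2 (by omega) (by omega) w hw
  · exact hφ.bound 0 3 (by omega) (by omega) w hw

theorem zero_mem_U : (0 : ℝ × ℝ) ∈ interior sq2 := by
  rw [mem_U]; norm_num

theorem abs_xx_le (hφ : Hyp M φ) (hM : 10 ≤ M) {z : ℝ × ℝ} (hz : z ∈ interior sq2) :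
    |pdx (pdx φ) z| ≤ 4 / 100000 := by
  have h := hφ.lip_xx hM zero_mem_U hz
  rw [hφ.hess_xx] at h
  have := mem_U.1 hz
  simp only [Prod.fst_zero, Prod.snd_zero, sub_zero] at h
  linarith

theorem abs_yy_le (hφ : Hyp M φ) (hM : 10 ≤ M) {z : ℝ × ℝ} (hz : z ∈ interior sq2) :
    |pdy (pdy φ) z| ≤ 4 / 100000 := by
  have h := hφ.lip_yy hM zero_mem_U hz
  rw [hφ.hess_yy] at h
  have := mem_U.1 hz
  simp only [Prod.fst_zero, Prod.snd_zero, sub_zero] at h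
  linarith

theorem abs_xy_sub_one_le (hφ : Hyp M φ) (hM : 10 ≤ M) {z : ℝ × ℝ} (hz : z ∈ interior sq2) :
    |pdx (pdy φ) z - 1| ≤ 4 / 100000 := by
  have h := hφ.lip_xy hM zero_mem_U hz
  rw [hφ.hess_xy] at h
  have := mem_U.1 hz
  simp only [Prod.fst_zero, Prod.snd_zero, sub_zero] at h
  linarith

end Hyp

/-! ### The functions φ_y − aφ_x and the Hessian form in a fixed direction -/

/-- The function `φ_y - a φ_x`, whose level curves have direction `(-a, 1)` where `A = a`. -/
def lev (φ : ℝ × ℝ → ℝ) (a : ℝ) (z : ℝ × ℝ) : ℝ := pdy φ z - a * pdx φ z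

/-- The value of the Hessian form at `(-a, 1)`. -/
def hessDir (φ : ℝ × ℝ → ℝ) (a : ℝ) (z : ℝ × ℝ) : ℝ :=
  pdy (pdy φ) z - 2 * a * pdx (pdy φ) z + a ^ 2 * pdx (pdx φ) z

theorem t2_eq (p z z' : ℝ × ℝ) :
    t2 φ p z z' = lev φ (coefA φ p) z' - lev φ (coefA φ p) z := by
  simp only [t2, lev]; ring

namespace Hyp

theorem contDiffOn_lev (hφ : Hyp M φ) (hM : 10 ≤ M) (a : ℝ) :
    ContDiffOn ℝ (1 : ℕ) (lev φ a) (interior sq2) :=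
  (contDiffOn_pdy (hφ.contDiffOn_U.of_le (by exact_mod_cast (by omega)))).sub
    (contDiffOn_const.mul
      (contDiffOn_pdx (hφ.contDiffOn_U.of_le (by exact_mod_cast (by omega)))))

theorem fderiv_lev (hφ : Hyp M φ) (hM : 10 ≤ M) (a : ℝ) {z : ℝ × ℝ} (hz : z ∈ interior sq2) :
    fderiv ℝ (lev φ a) z = fderiv ℝ (pdy φ) z - a • fderiv ℝ (pdx φ) z := by
  have hx : DifferentiableAt ℝ (pdx φ) z := differentiableAt_of_contDiffOn (n := 1) le_rfl
    (contDiffOn_pdx (hφ.contDiffOn_U.of_le (by exact_mod_cast (by omega)))) hz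
  have hy : DifferentiableAt ℝ (pdy φ) z := differentiableAt_of_contDiffOn (n := 1) le_rfl
    (contDiffOn_pdy (hφ.contDiffOn_U.of_le (by exact_mod_cast (by omega)))) hz
  exact (hy.hasFDerivAt.sub (hx.hasFDerivAt.const_mul a)).fderiv

theorem pdx_lev (hφ : Hyp M φ) (hM : 10 ≤ M) (a : ℝ) {z : ℝ × ℝ} (hz : z ∈ interior sq2) :
    pdx (lev φ a) z = pdx (pdy φ) z - a * pdx (pdx φ) z := by
  simp only [pdx, hφ.fderiv_lev hM a hz]; rfl

theorem pdy_lev (hφ : Hyp M φ) (hM : 10 ≤ M) (a : ℝ) {z : ℝ × ℝ} (hz : z ∈ interior sq2) :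
    pdy (lev φ a) z = pdy (pdy φ) z - a * pdx (pdy φ) z := by
  rw [← hφ.pdy_pdx hM hz, pdy, hφ.fderiv_lev hM a hz]; rfl

/-- For small a the gradient is close to (1, 0) throughout the interior of 2Σ, so `lev` is a
perturbation of the first coordinate and its level curves are nearly vertical graphs over y. -/
theorem lev_near (hφ : Hyp M φ) (hM : 10 ≤ M) {a : ℝ} (ha : |a| ≤ 1 / 10000) {z z' : ℝ × ℝ}
    (hz : z ∈ interior sq2) (hz' : z' ∈ interior sq2) :
    |lev φ a z' - lev φ a z - (z'.1 - z.1)| ≤ 1 / 1000 * (|z'.1 - z.1| + |z'.2 - z.2|) := by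
  obtain ⟨ξ, -, hξ, h⟩ := exists_mem_segment_sub_eq (hφ.contDiffOn_lev hM a) hz hz'
  rw [h, hφ.pdx_lev hM a hξ, hφ.pdy_lev hM a hξ]
  have h1 := hφ.abs_xx_le hM hξ
  have h2 := hφ.abs_xy_sub_one_le hM hξ
  have h3 := hφ.abs_yy_le hM hξ
  have h4 : |a * pdx (pdx φ) ξ| ≤ 1 / 10000 := by rw [abs_mul]; nlinarith [abs_nonneg a]
  have h5 : |a * pdx (pdy φ) ξ| ≤ 2 / 10000 := by
    rw [abs_mul]
    have : |pdx (pdy φ) ξ| ≤ 2 := by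
      rw [abs_le] at h2 ⊢; constructor <;> linarith [h2.1, h2.2]
    nlinarith [abs_nonneg a, abs_nonneg (pdx (pdy φ) ξ)]
  have e : (z'.1 - z.1) * (pdx (pdy φ) ξ - a * pdx (pdx φ) ξ)
      + (z'.2 - z.2) * (pdy (pdy φ) ξ - a * pdx (pdy φ) ξ) - (z'.1 - z.1)
      = (z'.1 - z.1) * (pdx (pdy φ) ξ - 1 - a * pdx (pdx φ) ξ)
      + (z'.2 - z.2) * (pdy (pdy φ) ξ - a * pdx (pdy φ) ξ) := by ring
  rw [e]
  refine (abs_add_le _ _).trans ?_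
  rw [abs_mul, abs_mul]
  have h6 := abs_sub (pdx (pdy φ) ξ - 1) (a * pdx (pdx φ) ξ)
  have h7 := abs_sub (pdy (pdy φ) ξ) (a * pdx (pdy φ) ξ)
  have h8 : |pdx (pdy φ) ξ - 1 - a * pdx (pdx φ) ξ| ≤ 1 / 1000 := by linarith
  have h9 : |pdy (pdy φ) ξ - a * pdx (pdy φ) ξ| ≤ 1 / 1000 := by linarith
  nlinarith [abs_nonneg (z'.1 - z.1), abs_nonneg (z'.2 - z.2)]

theorem pdx_lev_near (hφ : Hyp M φ) (hM : 10 ≤ M) {a : ℝ} (ha : |a| ≤ 1 / 10000) {z : ℝ × ℝ}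
    (hz : z ∈ interior sq2) : |pdx (lev φ a) z - 1| ≤ 1 / 1000 := by
  rw [hφ.pdx_lev hM a hz]
  have h1 := hφ.abs_xx_le hM hz
  have h2 := hφ.abs_xy_sub_one_le hM hz
  have h4 : |a * pdx (pdx φ) z| ≤ 1 / 10000 := by rw [abs_mul]; nlinarith [abs_nonneg a]
  rw [abs_le] at *
  constructor <;> linarith [h1.1, h1.2, h2.1, h2.2, h4.1, h4.2]

/-- Freezing the slope at z₀ costs its oscillation over a ball of radius ρ, which third derivatives
control. This is what makes an iteration with fixed slope contract by a factor O(ρ). -/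
theorem lev_horizontal (hφ : Hyp M φ) (hM : 10 ≤ M) {a : ℝ} (ha : |a| ≤ 1 / 10000)
    {z₀ : ℝ × ℝ} {x x' y ρ : ℝ} (hz₀ : z₀ ∈ interior sq2)
    (hz : (x, y) ∈ interior sq2) (hz' : (x', y) ∈ interior sq2) (hx : |x - z₀.1| ≤ ρ)
    (hx' : |x' - z₀.1| ≤ ρ) (hy : |y - z₀.2| ≤ ρ) :
    |lev φ a (x', y) - lev φ a (x, y) - pdx (lev φ a) z₀ * (x' - x)|
      ≤ ρ / 1000 * |x' - x| := by
  obtain ⟨ξ, hs, hξ, h⟩ := exists_mem_segment_sub_eq (hφ.contDiffOn_lev hM a) hz hz'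
  have hc : ξ ∈ Metric.closedBall z₀ ρ := by
    refine (convex_closedBall z₀ ρ).segment_subset ?_ ?_ hs <;>
    · rw [Metric.mem_closedBall, Prod.dist_eq, max_le_iff, Real.dist_eq, Real.dist_eq]
      exact ⟨by assumption, hy⟩
  rw [Metric.mem_closedBall, Prod.dist_eq, max_le_iff, Real.dist_eq, Real.dist_eq] at hc
  have e : lev φ a (x', y) - lev φ a (x, y) - pdx (lev φ a) z₀ * (x' - x)
      = (pdx (lev φ a) ξ - pdx (lev φ a) z₀) * (x' - x) := by rw [h]; ring
  rw [e, abs_mul, hφ.pdx_lev hM a hξ, hφ.pdx_lev hM a hz₀]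
  refine mul_le_mul_of_nonneg_right ?_ (abs_nonneg _)
  have h1 := hφ.lip_xx hM hz₀ hξ
  have h2 := hφ.lip_xy hM hz₀ hξ
  have e2 : pdx (pdy φ) ξ - a * pdx (pdx φ) ξ - (pdx (pdy φ) z₀ - a * pdx (pdx φ) z₀)
    = (pdx (pdy φ) ξ - pdx (pdy φ) z₀) - a * (pdx (pdx φ) ξ - pdx (pdx φ) z₀) := by ring
  rw [e2]
  refine (abs_sub _ _).trans ?_
  rw [abs_mul]
  have : |a| * |pdx (pdx φ) ξ - pdx (pdx φ) z₀| ≤ 1 * |pdx (pdx φ) ξ - pdx (pdx φ) z₀| :=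
    mul_le_mul_of_nonneg_right (by linarith) (abs_nonneg _)
  have := abs_nonneg (ξ.1 - z₀.1)
  linarith

/-- The directional derivative of `lev φ a` along (−a, 1) is exactly `hessDir φ a`; the mean value
theorem does the rest. -/
theorem lev_line (hφ : Hyp M φ) (hM : 10 ≤ M) (a : ℝ) {z : ℝ × ℝ} {t : ℝ}
    (hz : z ∈ interior sq2) (hz' : z + t • (-a, (1 : ℝ)) ∈ interior sq2) :
    ∃ θ ∈ Icc (0 : ℝ) 1, lev φ a (z + t • (-a, (1 : ℝ))) - lev φ a z
      = t * hessDir φ a (z + (θ * t) • (-a, (1 : ℝ))) := by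
  obtain ⟨ξ, hs, hξ, h⟩ := exists_mem_segment_sub_eq (hφ.contDiffOn_lev hM a) hz hz'
  rw [segment_eq_image'] at hs
  obtain ⟨θ, hθ, rfl⟩ := hs
  have e : z + θ • (z + t • (-a, (1 : ℝ)) - z) = z + (θ * t) • (-a, (1 : ℝ)) := by
    rw [add_sub_cancel_left, smul_smul]
  simp only [e] at hξ h
  refine ⟨θ, hθ, ?_⟩
  rw [h, hφ.pdx_lev hM a hξ, hφ.pdy_lev hM a hξ, hessDir]
  simp only [Prod.fst_add, Prod.snd_add, Prod.smul_fst, Prod.smul_snd, smul_eq_mul]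
  ring

theorem lip_hessDir (hφ : Hyp M φ) (hM : 10 ≤ M) {a : ℝ} (ha : |a| ≤ 1 / 10000) {z z' : ℝ × ℝ}
    (hz : z ∈ interior sq2) (hz' : z' ∈ interior sq2) :
    |hessDir φ a z' - hessDir φ a z| ≤ 1 / 10000 * (|z'.1 - z.1| + |z'.2 - z.2|) := by
  have h1 := hφ.lip_xx hM hz hz'
  have h2 := hφ.lip_xy hM hz hz'
  have h3 := hφ.lip_yy hM hz hz'
  have e : hessDir φ a z' - hessDir φ a z = (pdy (pdy φ) z' - pdy (pdy φ) z)
      - 2 * a * (pdx (pdy φ) z' - pdx (pdy φ) z) + a ^ 2 * (pdx (pdx φ) z' - pdx (pdx φ) z) := by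
    simp only [hessDir]; ring
  rw [e]
  refine (abs_add_le _ _).trans ?_
  have := abs_sub (pdy (pdy φ) z' - pdy (pdy φ) z) (2 * a * (pdx (pdy φ) z' - pdx (pdy φ) z))
  have i1 : |2 * a * (pdx (pdy φ) z' - pdx (pdy φ) z)| ≤ 1 * |pdx (pdy φ) z' - pdx (pdy φ) z| := by
    rw [abs_mul, abs_mul, abs_two]
    exact mul_le_mul_of_nonneg_right (by linarith) (abs_nonneg _)
  have i2 : |a ^ 2 * (pdx (pdx φ) z' - pdx (pdx φ) z)|
      ≤ 1 * |pdx (pdx φ) z' - pdx (pdx φ) z| := by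
    rw [abs_mul, abs_pow]
    exact mul_le_mul_of_nonneg_right (by nlinarith [abs_nonneg a]) (abs_nonneg _)
  have := abs_nonneg (z'.1 - z.1)
  have := abs_nonneg (z'.2 - z.2)
  linarith

theorem denominator_bounds (hφ : Hyp M φ) (hM : 10 ≤ M) {z : ℝ × ℝ} (hz : z ∈ interior sq2) :
    0 ≤ negHess φ z ∧ 19 / 10 ≤ pdx (pdy φ) z + √(negHess φ z) := by
  have h1 := abs_le.1 (hφ.abs_xx_le hM hz)
  have h2 := abs_le.1 (hφ.abs_xy_sub_one_le hM hz)
  have h3 := abs_le.1 (hφ.abs_yy_le hM hz)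
  have hH : (95 / 100) ^ 2 ≤ negHess φ z := by
    rw [negHess]
    nlinarith [mul_nonneg (sub_nonneg.2 h1.2) (sub_nonneg.2 h3.2),
      mul_nonneg (sub_nonneg.2 h1.1) (sub_nonneg.2 h3.1),
      mul_nonneg (sub_nonneg.2 h1.1) (sub_nonneg.2 h3.2),
      mul_nonneg (sub_nonneg.2 h1.2) (sub_nonneg.2 h3.1)]
  have := Real.le_sqrt_of_sq_le hH
  exact ⟨by linarith [sq_nonneg (95 / 100 : ℝ)], by linarith [h2.1]⟩

theorem abs_coefA_le (hφ : Hyp M φ) (hM : 10 ≤ M) {z : ℝ × ℝ} (hz : z ∈ interior sq2) :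
    |coefA φ z| ≤ 1 / 10000 := by
  have h := (hφ.denominator_bounds hM hz).2
  rw [coefA, abs_div, abs_of_pos (by linarith : 0 < pdx (pdy φ) z + √(negHess φ z)),
    div_le_iff₀ (by linarith)]
  linarith [hφ.abs_yy_le hM hz]

/-- As a quadratic polynomial in a, the Hessian form vanishes at a = A(z); subtracting this zero
value splits off the factor a − A(z). -/
theorem hessDir_eq (hφ : Hyp M φ) (hM : 10 ≤ M) (a : ℝ) {z : ℝ × ℝ} (hz : z ∈ interior sq2) :
    hessDir φ a z
      = (a - coefA φ z) * ((a + coefA φ z) * pdx (pdx φ) z - 2 * pdx (pdy φ) z) := by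
  obtain ⟨hH, hD⟩ := hφ.denominator_bounds hM hz
  have hA : coefA φ z * (pdx (pdy φ) z + √(negHess φ z)) = pdy (pdy φ) z :=
    div_mul_cancel₀ _ (by linarith)
  have hs : √(negHess φ z) ^ 2 = pdx (pdy φ) z ^ 2 - pdx (pdx φ) z * pdy (pdy φ) z :=
    Real.sq_sqrt hH
  set D := pdx (pdy φ) z + √(negHess φ z) with hDdef
  have hsD : √(negHess φ z) = D - pdx (pdy φ) z := by rw [hDdef]; ring
  rw [hsD] at hs
  have key : hessDir φ (coefA φ z) z = 0 := by
    have : D * hessDir φ (coefA φ z) z = 0 := by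
      rw [hessDir, ← hA]
      rw [← hA] at hs
      linear_combination (coefA φ z) * hs
    exact (mul_eq_zero.1 this).resolve_left (by linarith)
  have e : hessDir φ a z = hessDir φ a z - hessDir φ (coefA φ z) z := by rw [key, sub_zero]
  rw [e]
  simp only [hessDir]
  ring

/-- The cofactor of a − A is close to −2. So `hessDir` can stand in for A − a, and unlike A it is
linear in the second derivatives of φ, so that Taylor's formula applies to it directly. -/
theorem abs_hessDir (hφ : Hyp M φ) (hM : 10 ≤ M) {a : ℝ} (ha : |a| ≤ 1 / 10000) {z : ℝ × ℝ}
    (hz : z ∈ interior sq2) :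
    |coefA φ z - a| ≤ |hessDir φ a z| ∧ |hessDir φ a z| ≤ 21 / 10 * |coefA φ z - a| := by
  have h1 := hφ.abs_xx_le hM hz
  have h2 := abs_le.1 (hφ.abs_xy_sub_one_le hM hz)
  have h3 := hφ.abs_coefA_le hM hz
  have h4 : |(a + coefA φ z) * pdx (pdx φ) z| ≤ 1 / 1000 := by
    rw [abs_mul]
    nlinarith [abs_add_le a (coefA φ z), abs_nonneg (pdx (pdx φ) z),
      abs_nonneg (a + coefA φ z)]
  rw [abs_le] at h4
  have e : |(a + coefA φ z) * pdx (pdx φ) z - 2 * pdx (pdy φ) z|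
      = 2 * pdx (pdy φ) z - (a + coefA φ z) * pdx (pdx φ) z := by
    rw [abs_of_nonpos (by linarith [h4.1, h4.2, h2.1, h2.2])]; ring
  rw [hφ.hessDir_eq hM a hz, abs_mul, e, abs_sub_comm a]
  have := abs_nonneg (coefA φ z - a)
  constructor
  · nlinarith
  · nlinarith

theorem coefA_swap (hφ : Hyp M φ) (hM : 10 ≤ M) {z : ℝ × ℝ} (hz : z ∈ interior sq2) :
    coefA (φ ∘ Prod.swap) z.swap = coefB φ z := by
  simp only [coefA, coefB, negHess, pdx_comp_swap, pdy_comp_swap, Function.comp_apply,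
    Prod.swap_swap]
  rw [hφ.pdy_pdx hM hz, mul_comm (pdy (pdy φ) z)]

theorem t1_eq_t2_swap (hφ : Hyp M φ) (hM : 10 ≤ M) {p : ℝ × ℝ} (hp : p ∈ interior sq2)
    (z z' : ℝ × ℝ) : t1 φ p z z' = t2 (φ ∘ Prod.swap) p.swap z.swap z'.swap := by
  simp only [t1, t2, hφ.coefA_swap hM hp, pdx_comp_swap, pdy_comp_swap, Function.comp_apply,
    Prod.swap_swap]

theorem t2_eq_t1_swap (hφ : Hyp M φ) (hM : 10 ≤ M) {p : ℝ × ℝ} (hp : p ∈ interior sq2)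
    (z z' : ℝ × ℝ) : t2 φ p z z' = t1 (φ ∘ Prod.swap) p.swap z.swap z'.swap := by
  rw [hφ.swap.t1_eq_t2_swap hM (swap_mem_U hp)]
  rfl

end Hyp

/-! ### Polynomial approximation by Taylor's formula -/

/-- Induction on m: the derivative of the remainder is the remainder of the derivative, and the
remainder vanishes at t₀, so the mean value inequality gains one factor |t − t₀|. The factorial in
the usual error term is given up. -/
theorem abs_sub_taylor_le {m : ℕ} {g : ℕ → ℝ → ℝ} {s : Set ℝ} (hs : Convex ℝ s) {t₀ B : ℝ}
    (ht₀ : t₀ ∈ s) (hg : ∀ i < m, ∀ t ∈ s, HasDerivAt (g i) (g (i + 1) t) t)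
    (hB : ∀ t ∈ s, |g m t| ≤ B) {t : ℝ} (ht : t ∈ s) :
    |g 0 t - ∑ i ∈ Finset.range m, g i t₀ / i.factorial * (t - t₀) ^ i| ≤ B * |t - t₀| ^ m := by
  induction m generalizing g t with
  | zero => simpa using hB t ht
  | succ m ih =>
    have hB0 : 0 ≤ B := (abs_nonneg _).trans (hB _ ht)
    have ih' : ∀ u ∈ s, _ := fun u hu => ih (g := fun i => g (i + 1))
      (fun i hi => hg (i + 1) (by omega)) hB hu
    set R : ℝ → ℝ := fun u =>
      g 0 u - ∑ i ∈ Finset.range (m + 1), g i t₀ / i.factorial * (u - t₀) ^ i with hR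
    have hRd : ∀ u ∈ s, HasDerivAt R
        (g 1 u - ∑ i ∈ Finset.range m, g (i + 1) t₀ / i.factorial * (u - t₀) ^ i) u := by
      intro u hu
      refine (hg 0 (by omega) u hu).sub ?_
      have : ∀ i ∈ Finset.range (m + 1), HasDerivAt
          (fun u => g i t₀ / i.factorial * (u - t₀) ^ i)
          (g i t₀ / i.factorial * (i * (u - t₀) ^ (i - 1))) u := fun i _ => by
        have := ((hasDerivAt_id u).sub_const t₀).pow i
        simpa using this.const_mul (g i t₀ / i.factorial)
      refine (HasDerivAt.fun_sum this).congr_deriv ?_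
      rw [Finset.sum_range_succ']
      simp only [Nat.cast_zero, zero_mul, mul_zero, add_zero, Nat.add_sub_cancel]
      refine Finset.sum_congr rfl fun i _ => ?_
      rw [Nat.factorial_succ]
      push_cast
      have h1 : (i.factorial : ℝ) ≠ 0 := by positivity
      have h2 : (i : ℝ) + 1 ≠ 0 := by positivity
      field_simp
    have hseg : uIcc t₀ t ⊆ s := by
      rw [← segment_eq_uIcc]; exact hs.segment_subset ht₀ ht
    have hmv := (convex_uIcc t₀ t).norm_image_sub_le_of_norm_hasDerivWithin_le
      (f := R) (C := B * |t - t₀| ^ m)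
      (fun u hu => (hRd u (hseg hu)).hasDerivWithinAt)
      (fun u hu => by
        rw [Real.norm_eq_abs]
        refine (ih' u (hseg hu)).trans ?_
        have : |u - t₀| ≤ |t - t₀| := by
          have := abs_sub_left_of_mem_uIcc hu
          simpa using this
        gcongr)
      left_mem_uIcc right_mem_uIcc
    have hR0 : R t₀ = 0 := by
      simp only [hR]
      rw [Finset.sum_range_succ']
      simp
    rw [hR0, sub_zero, Real.norm_eq_abs, Real.norm_eq_abs, mul_assoc, ← pow_succ] at hmv
    exact hmv

/-- `f` is within `η` of a polynomial of degree less than `m` in each variable on the square with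
centre `z₀` and side length `2ρ`. -/
def PolyApprox (m : ℕ) (f : ℝ × ℝ → ℝ) (z₀ : ℝ × ℝ) (ρ η : ℝ) : Prop :=
  ∃ g : ℕ → ℕ → ℝ, ∀ z : ℝ × ℝ, |z.1 - z₀.1| ≤ ρ → |z.2 - z₀.2| ≤ ρ →
    |f z - ∑ j ∈ Finset.range m, ∑ i ∈ Finset.range m,
      g i j * (z.1 - z₀.1) ^ i * (z.2 - z₀.2) ^ j| ≤ η

theorem PolyApprox.add {m : ℕ} {f₁ f₂ : ℝ × ℝ → ℝ} {z₀ : ℝ × ℝ} {ρ η₁ η₂ : ℝ}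
    (h₁ : PolyApprox m f₁ z₀ ρ η₁) (h₂ : PolyApprox m f₂ z₀ ρ η₂) :
    PolyApprox m (fun z => f₁ z + f₂ z) z₀ ρ (η₁ + η₂) := by
  obtain ⟨g₁, h₁⟩ := h₁
  obtain ⟨g₂, h₂⟩ := h₂
  refine ⟨fun i j => g₁ i j + g₂ i j, fun z hx hy => ?_⟩
  simp only [add_mul, Finset.sum_add_distrib]
  rw [add_sub_add_comm]
  exact (abs_add_le _ _).trans (add_le_add (h₁ z hx hy) (h₂ z hx hy))

theorem PolyApprox.const_mul {m : ℕ} {f : ℝ × ℝ → ℝ} {z₀ : ℝ × ℝ} {ρ η : ℝ}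
    (h : PolyApprox m f z₀ ρ η) {c : ℝ} (hc : |c| ≤ 2) :
    PolyApprox m (fun z => c * f z) z₀ ρ (2 * η) := by
  obtain ⟨g, h⟩ := h
  refine ⟨fun i j => c * g i j, fun z hx hy => ?_⟩
  simp only [mul_assoc c, ← Finset.mul_sum]
  rw [← mul_sub, abs_mul]
  exact mul_le_mul hc (h z hx hy) (abs_nonneg _) zero_le_two

theorem hasDerivAt_vertical {f : ℝ × ℝ → ℝ} (hf : ContDiffOn ℝ (1 : ℕ) f (interior sq2))
    {x y : ℝ} (hz : (x, y) ∈ interior sq2) :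
    HasDerivAt (fun t => f (x, t)) (pdy f (x, y)) y :=
  (differentiableAt_of_contDiffOn le_rfl hf hz).hasFDerivAt.comp_hasDerivAt y
    ((hasDerivAt_const y x).prodMk (hasDerivAt_id y))

theorem hasDerivAt_horizontal {f : ℝ × ℝ → ℝ} (hf : ContDiffOn ℝ (1 : ℕ) f (interior sq2))
    {x y : ℝ} (hz : (x, y) ∈ interior sq2) :
    HasDerivAt (fun t => f (t, y)) (pdx f (x, y)) x :=
  (differentiableAt_of_contDiffOn le_rfl hf hz).hasFDerivAt.comp_hasDerivAt x
    ((hasDerivAt_id x).prodMk (hasDerivAt_const x y))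

/-- Expand in y to order m at fixed x, then expand the j-th coefficient in x to order m − j. Each of
these m + 1 one-dimensional expansions costs at most Bρ^m. -/
theorem polyApprox_of_partials {m : ℕ} {f : ℝ × ℝ → ℝ} (hf : ContDiffOn ℝ m f (interior sq2))
    {B : ℝ} (hB : ∀ i j, i + j = m → ∀ z ∈ interior sq2, |(pdx^[i] (pdy^[j] f)) z| ≤ B)
    {z₀ : ℝ × ℝ} {ρ : ℝ} (hz₀ : |z₀.1| + ρ < 2 ∧ |z₀.2| + ρ < 2) (hρ : 0 ≤ ρ) :
    PolyApprox m f z₀ ρ ((m + 1) * (B * ρ ^ m)) := by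
  have hU : ∀ x y, |x - z₀.1| ≤ ρ → |y - z₀.2| ≤ ρ → (x, y) ∈ interior sq2 := fun x y hx hy => by
    rw [mem_U]
    constructor
    · have := abs_add_le (x - z₀.1) z₀.1
      rw [sub_add_cancel] at this; exact lt_of_le_of_lt this (by linarith)
    · have := abs_add_le (y - z₀.2) z₀.2
      rw [sub_add_cancel] at this; exact lt_of_le_of_lt this (by linarith)
  have hcv : ∀ c : ℝ, Convex ℝ {t | |t - c| ≤ ρ} := fun c => by
    have := convex_closedBall c ρ
    simpa only [Metric.closedBall, Real.dist_eq] using this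
  have hc : ∀ i j, i + j < m → ContDiffOn ℝ (1 : ℕ) (pdx^[i] (pdy^[j] f)) (interior sq2) :=
    fun i j hij => contDiffOn_iterate_pdx (contDiffOn_iterate_pdy
      (hf.of_le (by exact_mod_cast (by omega))))
  have hB0 : 0 ≤ B := (abs_nonneg _).trans (hB m 0 rfl _ (hU z₀.1 z₀.2 (by simpa) (by simpa)))
  refine ⟨fun i j => if i + j < m then
    (pdx^[i] (pdy^[j] f)) z₀ / i.factorial / j.factorial else 0, fun z hx hy => ?_⟩
  have hy0 : |z₀.2 - z₀.2| ≤ ρ := by simpa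
  have hx0 : |z₀.1 - z₀.1| ≤ ρ := by simpa
  have step1 := abs_sub_taylor_le (m := m) (g := fun j t => (pdy^[j] f) (z.1, t)) (hcv z₀.2)
    (t₀ := z₀.2) (B := B) hy0
    (fun j hj t ht => by
      simp only [Function.iterate_succ_apply']
      exact hasDerivAt_vertical (hc 0 j (by omega)) (hU _ _ hx ht))
    (fun t ht => hB 0 m (by omega) _ (hU _ _ hx ht)) (t := z.2) hy
  have step2 : ∀ j ∈ Finset.range m,
      |(pdy^[j] f) (z.1, z₀.2) / j.factorial * (z.2 - z₀.2) ^ j -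
        ∑ i ∈ Finset.range m, (if i + j < m then
          (pdx^[i] (pdy^[j] f)) z₀ / i.factorial / j.factorial else 0)
            * (z.1 - z₀.1) ^ i * (z.2 - z₀.2) ^ j| ≤ B * ρ ^ m := by
    intro j hj
    rw [Finset.mem_range] at hj
    have h := abs_sub_taylor_le (m := m - j) (g := fun i t => (pdx^[i] (pdy^[j] f)) (t, z₀.2))
      (hcv z₀.1) (t₀ := z₀.1) (B := B) hx0
      (fun i hi t ht => by
        simp only [Function.iterate_succ_apply']
        exact hasDerivAt_horizontal (hc i j (by omega)) (hU _ _ ht hy0))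
      (fun t ht => hB (m - j) j (by omega) _ (hU _ _ ht hy0)) (t := z.1) hx
    have e : ∑ i ∈ Finset.range m, (if i + j < m then
          (pdx^[i] (pdy^[j] f)) z₀ / i.factorial / j.factorial else 0)
            * (z.1 - z₀.1) ^ i * (z.2 - z₀.2) ^ j
        = (∑ i ∈ Finset.range (m - j), (pdx^[i] (pdy^[j] f)) z₀ / i.factorial
            * (z.1 - z₀.1) ^ i) * ((z.2 - z₀.2) ^ j / j.factorial) := by
      rw [Finset.sum_mul]
      rw [← Finset.sum_subset (Finset.range_subset_range.2 (Nat.sub_le m j))]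
      · refine Finset.sum_congr rfl fun i hi => ?_
        rw [Finset.mem_range] at hi
        rw [if_pos (by omega)]; ring
      · intro i _ hi
        rw [Finset.mem_range] at hi
        rw [if_neg (by omega)]; ring
    have e2 : (pdy^[j] f) (z.1, z₀.2) / j.factorial * (z.2 - z₀.2) ^ j
        = (pdy^[j] f) (z.1, z₀.2) * ((z.2 - z₀.2) ^ j / j.factorial) := by ring
    rw [e, e2, ← sub_mul, abs_mul]
    have h3 : |(z.2 - z₀.2) ^ j / j.factorial| ≤ ρ ^ j := by
      rw [abs_div, abs_pow, Nat.abs_cast]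
      refine (div_le_self (by positivity) (by exact_mod_cast Nat.factorial_pos j)).trans ?_
      gcongr
    have h4 : B * |z.1 - z₀.1| ^ (m - j) ≤ B * ρ ^ (m - j) := by gcongr
    calc _ ≤ (B * ρ ^ (m - j)) * ρ ^ j := mul_le_mul (h.trans h4) h3 (abs_nonneg _) (by positivity)
      _ = B * ρ ^ m := by rw [mul_assoc, ← pow_add, Nat.sub_add_cancel hj.le]
  have h5 : B * |z.2 - z₀.2| ^ m ≤ B * ρ ^ m := by gcongr
  have e3 : f z - ∑ j ∈ Finset.range m, ∑ i ∈ Finset.range m, (if i + j < m then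
          (pdx^[i] (pdy^[j] f)) z₀ / i.factorial / j.factorial else 0)
            * (z.1 - z₀.1) ^ i * (z.2 - z₀.2) ^ j
      = (f z - ∑ j ∈ Finset.range m, (pdy^[j] f) (z.1, z₀.2) / j.factorial * (z.2 - z₀.2) ^ j)
        + ∑ j ∈ Finset.range m, ((pdy^[j] f) (z.1, z₀.2) / j.factorial * (z.2 - z₀.2) ^ j -
        ∑ i ∈ Finset.range m, (if i + j < m then
          (pdx^[i] (pdy^[j] f)) z₀ / i.factorial / j.factorial else 0)
            * (z.1 - z₀.1) ^ i * (z.2 - z₀.2) ^ j) := by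
    rw [Finset.sum_sub_distrib]; ring
  rw [e3]
  refine (abs_add_le _ _).trans ?_
  have h6 := (Finset.abs_sum_le_sum_abs _ _).trans (Finset.sum_le_sum step2)
  rw [Finset.sum_const, Finset.card_range, nsmul_eq_mul] at h6
  have h7 := step1.trans h5
  simp only [Function.iterate_zero, id, Prod.mk.eta] at h7
  linarith

theorem Hyp.polyApprox_partial (hφ : Hyp M φ) (hM : 10 ≤ M) {a b : ℕ} (hab : a + b ≤ 2)
    {z₀ : ℝ × ℝ} {ρ : ℝ} (hz₀ : |z₀.1| + ρ < 2 ∧ |z₀.2| + ρ < 2) (hρ : 0 ≤ ρ) :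
    PolyApprox (M - 2) (pdx^[a] (pdy^[b] φ)) z₀ ρ (M * ρ ^ (M - 2)) := by
  have h : PolyApprox (M - 2) (pdx^[a] (pdy^[b] φ)) z₀ ρ
      (((M - 2 : ℕ) + 1) * (1 * ρ ^ (M - 2))) := by
    refine polyApprox_of_partials ?_ ?_ hz₀ hρ
    · exact contDiffOn_iterate_pdx (contDiffOn_iterate_pdy
        (hφ.contDiffOn_U.of_le (by exact_mod_cast (by omega))))
    · intro i j hij z hz
      have hc : ContDiffOn ℝ (j + a : ℕ) (pdy^[b] φ) (interior sq2) :=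
        contDiffOn_iterate_pdy (hφ.contDiffOn_U.of_le (by exact_mod_cast (by omega)))
      rw [iterate_pdx_congr (iterate_pdy_iterate_pdx_comm hc) i hz, ← Function.iterate_add_apply,
        ← Function.iterate_add_apply]
      exact (hφ.bound (i + a) (j + b) (by omega) (by omega) z hz).trans (by norm_num)
  obtain ⟨g, hg⟩ := h
  refine ⟨g, fun z hx hy => (hg z hx hy).trans ?_⟩
  rw [one_mul]
  refine mul_le_mul_of_nonneg_right ?_ (by positivity)
  rw [Nat.cast_sub (by omega)]; push_cast; linarith

theorem Hyp.polyApprox_lev (hφ : Hyp M φ) (hM : 10 ≤ M) {a : ℝ} (ha : |a| ≤ 1)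
    {z₀ : ℝ × ℝ} {ρ : ℝ} (hz₀ : |z₀.1| + ρ < 2 ∧ |z₀.2| + ρ < 2) (hρ : 0 ≤ ρ) :
    PolyApprox (M - 2) (lev φ a) z₀ ρ (5 * (M * ρ ^ (M - 2))) := by
  have h1 := hφ.polyApprox_partial hM (a := 1) (b := 0) (by omega) hz₀ hρ
  have h2 := hφ.polyApprox_partial hM (a := 0) (b := 1) (by omega) hz₀ hρ
  have h := h2.add (h1.const_mul (c := -a) (by rw [abs_neg]; linarith))
  obtain ⟨g, hg⟩ := h
  refine ⟨g, fun z hx hy => ?_⟩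
  have := hg z hx hy
  have e : lev φ a z = (pdx^[0] (pdy^[1] φ)) z + -a * (pdx^[1] (pdy^[0] φ)) z := by
    simp only [lev, Function.iterate_zero, Function.iterate_succ, Function.comp_apply, id]; ring
  rw [e]
  refine this.trans ?_
  have : 0 ≤ (M : ℝ) * ρ ^ (M - 2) := by positivity
  linarith

/-- The coefficients −2a and a² are at most 2 in modulus, whence the factor 5 = 1 + 2 + 2. -/
theorem Hyp.polyApprox_hessDir (hφ : Hyp M φ) (hM : 10 ≤ M) {a : ℝ} (ha : |a| ≤ 1)
    {z₀ : ℝ × ℝ} {ρ : ℝ} (hz₀ : |z₀.1| + ρ < 2 ∧ |z₀.2| + ρ < 2) (hρ : 0 ≤ ρ) :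
    PolyApprox (M - 2) (hessDir φ a) z₀ ρ (5 * (M * ρ ^ (M - 2))) := by
  have h1 := hφ.polyApprox_partial hM (a := 2) (b := 0) (by omega) hz₀ hρ
  have h2 := hφ.polyApprox_partial hM (a := 1) (b := 1) (by omega) hz₀ hρ
  have h3 := hφ.polyApprox_partial hM (a := 0) (b := 2) (by omega) hz₀ hρ
  have h := (h3.add (h2.const_mul (c := -(2 * a)) (by
    rw [abs_neg, abs_mul, abs_two]; linarith))).add
    (h1.const_mul (c := a ^ 2) (by rw [abs_pow]; nlinarith [abs_nonneg a]))
  obtain ⟨g, hg⟩ := h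
  refine ⟨g, fun z hx hy => ?_⟩
  have := hg z hx hy
  have e : hessDir φ a z = (pdx^[0] (pdy^[2] φ)) z + -(2 * a) * (pdx^[1] (pdy^[1] φ)) z
      + a ^ 2 * (pdx^[2] (pdy^[0] φ)) z := by
    simp only [hessDir, Function.iterate_zero, Function.iterate_succ, Function.comp_apply, id]; ring
  rw [e]
  refine this.trans ?_
  have : 0 ≤ (M : ℝ) * ρ ^ (M - 2) := by positivity
  linarith

/-! ### Level curves as polynomial graphs: Newton iteration -/

open Polynomial in
/-- The substitution of `γ` for the first variable in a polynomial in two variables. -/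
def substPoly (m : ℕ) (g : ℕ → ℕ → ℝ) (z₀ : ℝ × ℝ) (γ : ℝ[X]) : ℝ[X] :=
  ∑ j ∈ Finset.range m, ∑ i ∈ Finset.range m,
    C (g i j) * (γ - C z₀.1) ^ i * (X - C z₀.2) ^ j

theorem eval_substPoly (m : ℕ) (g : ℕ → ℕ → ℝ) (z₀ : ℝ × ℝ) (γ : Polynomial ℝ) (y : ℝ) :
    (substPoly m g z₀ γ).eval y = ∑ j ∈ Finset.range m, ∑ i ∈ Finset.range m,
      g i j * (γ.eval y - z₀.1) ^ i * (y - z₀.2) ^ j := by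
  simp [substPoly, Polynomial.eval_finsetSum]

theorem natDegree_substPoly_le (m : ℕ) (g : ℕ → ℕ → ℝ) (z₀ : ℝ × ℝ) (γ : Polynomial ℝ) :
    (substPoly m g z₀ γ).natDegree ≤ m * (γ.natDegree + 1) := by
  refine Polynomial.natDegree_sum_le_of_forall_le _ _ fun j hj => ?_
  refine Polynomial.natDegree_sum_le_of_forall_le _ _ fun i hi => ?_
  rw [Finset.mem_range] at hi hj
  have h1 : (Polynomial.C (g i j) * (γ - Polynomial.C z₀.1) ^ i).natDegree ≤ i * γ.natDegree := by
    refine (Polynomial.natDegree_C_mul_le _ _).trans (Polynomial.natDegree_pow_le.trans ?_)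
    rw [Polynomial.natDegree_sub_C]
  have h2 : ((Polynomial.X - Polynomial.C z₀.2 : Polynomial ℝ) ^ j).natDegree ≤ j * 1 := by
    refine Polynomial.natDegree_pow_le.trans ?_
    rw [Polynomial.natDegree_X_sub_C]
  refine Polynomial.natDegree_mul_le.trans ((add_le_add h1 h2).trans ?_)
  rw [mul_one, mul_add, mul_one]
  exact add_le_add (Nat.mul_le_mul_right _ hi.le) hj.le

/-- A bound for the degree of the `k`-th Newton iterate. -/
def degBound (m : ℕ) : ℕ → ℕ
  | 0 => 0
  | k + 1 => degBound m k + m * (degBound m k + 1)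

theorem near_mem_U {z₀ : ℝ × ℝ} (hz₀ : z₀ ∈ sq) {x y ρ : ℝ} (hρ : ρ < 1) (hx : |x - z₀.1| ≤ ρ)
    (hy : |y - z₀.2| ≤ ρ) : (x, y) ∈ interior sq2 := by
  rw [mem_sq] at hz₀
  rw [mem_U]
  have h1 := abs_add_le (x - z₀.1) z₀.1
  have h2 := abs_add_le (y - z₀.2) z₀.2
  rw [sub_add_cancel] at h1 h2
  exact ⟨by linarith, by linarith⟩

/-- A level curve of `lev φ a` is close to the graph of a polynomial of controlled degree. -/
theorem Hyp.exists_newton (hφ : Hyp M φ) (hM : 10 ≤ M) {a : ℝ} (ha : |a| ≤ 1 / 10000)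
    {z₀ : ℝ × ℝ} (hz₀ : z₀ ∈ sq) {m : ℕ} {h η G₀ : ℝ} (hh0 : 0 < h) (hh : h ≤ 1 / 100)
    (hη : η ≤ h / 1000) (hP : PolyApprox m (lev φ a) z₀ (2 * h) η)
    (hG₀ : |lev φ a z₀ - G₀| ≤ h / 40) (k : ℕ) :
    ∃ γ : Polynomial ℝ, γ.natDegree ≤ degBound m k ∧ ∀ y, |y - z₀.2| ≤ h →
      |γ.eval y - z₀.1| ≤ h ∧ |lev φ a (γ.eval y, y) - G₀| ≤ h ^ k * (h / 20) + 4 * η := by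
  obtain ⟨g, hg⟩ := hP
  have hη0 : 0 ≤ η := (abs_nonneg _).trans (hg z₀ (by simp [hh0.le]) (by simp [hh0.le]))
  -- The vertical line through z₀ is the initial guess: its residual is at most h/40 from z₀ plus
  -- h/1000 from the drift of `lev` along it, which is below h/20.
  have hbase : ∀ y, |y - z₀.2| ≤ h → |lev φ a (z₀.1, y) - G₀| ≤ 26 / 1000 * h := fun y hy => by
    have := hφ.lev_near hM ha (z := z₀) (z' := (z₀.1, y))
      (near_mem_U hz₀ (ρ := h) (x := z₀.1) (y := z₀.2) (by linarith) (by simp [hh0.le])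
        (by simp [hh0.le]))
      (near_mem_U hz₀ (ρ := h) (by linarith) (by simp [hh0.le]) hy)
    simp only [sub_self, abs_zero, zero_add, sub_zero] at this
    rw [abs_le] at *
    constructor <;> linarith [this.1, this.2, hG₀.1, hG₀.2, abs_le.2 hy]
  induction k with
  | zero =>
    refine ⟨Polynomial.C z₀.1, by simp, fun y hy => ⟨by simp [hh0.le], ?_⟩⟩
    rw [Polynomial.eval_C]
    linarith [hbase y hy]
  | succ k ih =>
    obtain ⟨γ, hdeg, hγ⟩ := ih
    -- The slope is frozen at z₀, and `lev` is replaced by its approximating polynomial, so that the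
    -- next iterate is again a polynomial. Up to O(η), the residual shrinks by a factor h in each
    -- step.
    set a₁ := pdx (lev φ a) z₀ with ha₁
    have ha₁' : |a₁ - 1| ≤ 1 / 1000 := hφ.pdx_lev_near hM ha
      (near_mem_U hz₀ (ρ := h) (x := z₀.1) (y := z₀.2) (by linarith) (by simp [hh0.le])
        (by simp [hh0.le]))
    have ha₁l : 999 / 1000 ≤ a₁ := by linarith [(abs_le.1 ha₁').1]
    refine ⟨γ - Polynomial.C a₁⁻¹ * (substPoly m g z₀ γ - Polynomial.C G₀), ?_, fun y hy => ?_⟩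
    · refine (Polynomial.natDegree_sub_le _ _).trans (max_le ?_ ?_)
      · exact hdeg.trans (Nat.le_add_right _ _)
      · refine (Polynomial.natDegree_C_mul_le _ _).trans ?_
        rw [Polynomial.natDegree_sub_C]
        refine (natDegree_substPoly_le m g z₀ γ).trans ?_
        exact (Nat.mul_le_mul_left _ (by omega)).trans (Nat.le_add_left _ _)
    · obtain ⟨h1, h2⟩ := hγ y hy
      have hpow : h ^ k ≤ 1 := pow_le_one₀ hh0.le (by linarith)
      have hpow0 : 0 ≤ h ^ k := by positivity
      set x := γ.eval y with hx
      set p := (substPoly m g z₀ γ).eval y with hp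
      have h3 : |lev φ a (x, y) - p| ≤ η := by
        have := hg (x, y) (by simp only; linarith) (by simp only; linarith)
        rwa [← eval_substPoly] at this
      have hev : (γ - Polynomial.C a₁⁻¹ * (substPoly m g z₀ γ - Polynomial.C G₀)).eval y
          = x - a₁⁻¹ * (p - G₀) := by simp [hx, hp]
      rw [hev]
      set x' := x - a₁⁻¹ * (p - G₀) with hx'
      have h4 : a₁ * (x' - x) = -(p - G₀) := by
        rw [hx']; field_simp; ring
      have hpG : |p - G₀| ≤ h ^ k * (h / 20) + 5 * η := by
        have := abs_sub_le p (lev φ a (x, y)) G₀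
        rw [abs_sub_comm p (lev φ a (x, y))] at this
        linarith
      have h5 : |x' - x| ≤ 11 / 10 * (h ^ k * (h / 20) + 5 * η) := by
        have e : |a₁| * |x' - x| = |p - G₀| := by rw [← abs_mul, h4, abs_neg]
        rw [abs_of_pos (by linarith)] at e
        nlinarith [abs_nonneg (x' - x)]
      have hkh : h ^ k * (h / 20) ≤ h / 20 := by nlinarith
      have h6 : |x' - z₀.1| ≤ 2 * h := by
        have := abs_add_le (x' - x) (x - z₀.1)
        rw [sub_add_sub_cancel] at this
        linarith
      have hz0U : z₀ ∈ interior sq2 := near_mem_U hz₀ (ρ := h) (x := z₀.1) (y := z₀.2)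
        (by linarith) (by simp [hh0.le]) (by simp [hh0.le])
      have h7 := hφ.lev_horizontal hM ha (z₀ := z₀) (x := x) (x' := x') (y := y) (ρ := 2 * h) hz0U
        (near_mem_U hz₀ (ρ := 2 * h) (by linarith) (by linarith) (by linarith))
        (near_mem_U hz₀ (ρ := 2 * h) (by linarith) h6 (by linarith)) (by linarith) h6 (by linarith)
      rw [← ha₁, h4] at h7
      have h8 : 2 * h / 1000 * |x' - x| ≤ h * (h ^ k * (h / 20)) + η := by
        have : 2 * h / 1000 * |x' - x| ≤ 2 * h / 1000 * (11 / 10 * (h ^ k * (h / 20) + 5 * η)) := by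
          gcongr
        nlinarith [mul_nonneg hh0.le (mul_nonneg hpow0 hh0.le), mul_nonneg hη0 hh0.le]
      have h9 : |lev φ a (x', y) - G₀| ≤ h ^ (k + 1) * (h / 20) + 4 * η := by
        have e : lev φ a (x', y) - G₀ = (lev φ a (x', y) - lev φ a (x, y) - -(p - G₀))
            + (lev φ a (x, y) - p) := by ring
        rw [e, pow_succ]
        refine (abs_add_le _ _).trans ?_
        linarith
      refine ⟨?_, h9⟩
      have h10 := hφ.lev_near hM ha (z := (z₀.1, y)) (z' := (x', y))
        (near_mem_U hz₀ (ρ := h) (by linarith) (by simp [hh0.le]) hy)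
        (near_mem_U hz₀ (ρ := 2 * h) (by linarith) h6 (by linarith))
      simp only [sub_self, abs_zero, add_zero] at h10
      have h11 := hbase y hy
      have hk1 : h ^ (k + 1) * (h / 20) ≤ h / 20 := by
        have : h ^ (k + 1) ≤ 1 := pow_le_one₀ hh0.le (by linarith)
        nlinarith
      have e : x' - z₀.1 = (lev φ a (x', y) - G₀) - (lev φ a (z₀.1, y) - G₀)
          - (lev φ a (x', y) - lev φ a (z₀.1, y) - (x' - z₀.1)) := by ring
      have h12 := abs_sub ((lev φ a (x', y) - G₀) - (lev φ a (z₀.1, y) - G₀))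
        (lev φ a (x', y) - lev φ a (z₀.1, y) - (x' - z₀.1))
      have h13 := abs_sub (lev φ a (x', y) - G₀) (lev φ a (z₀.1, y) - G₀)
      rw [← e] at h12
      linarith

/-! ### Intervals of the level curve on which A stays close to a -/

/-- The number of values of the labels in `Hyp.exists_label`. -/
def labelBound (M : ℕ) : ℕ := 2 * ((M - 2) * (degBound (M - 2) M + 1))

theorem lev_close (hφ : Hyp M φ) (hM : 10 ≤ M) {a : ℝ} (ha : |a| ≤ 1 / 10000) {x x' y : ℝ}
    (h : (x, y) ∈ interior sq2) (h' : (x', y) ∈ interior sq2) :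
    9 / 10 * |x' - x| ≤ |lev φ a (x', y) - lev φ a (x, y)| := by
  have h1 := hφ.lev_near hM ha h h'
  simp only [sub_self, abs_zero, add_zero] at h1
  have h2 := abs_sub (lev φ a (x', y) - lev φ a (x, y))
    (lev φ a (x', y) - lev φ a (x, y) - (x' - x))
  rw [sub_sub_cancel] at h2
  linarith [abs_nonneg (x' - x)]

/-- The part of a thin neighbourhood of a level curve of `lev φ a` where `A` is close to `a`. -/
def levelSet (φ : ℝ × ℝ → ℝ) (a G₀ δ s : ℝ) : Set (ℝ × ℝ) :=
  {z ∈ sq | |lev φ a z - G₀| ≤ 60 * δ ∧ |hessDir φ a z| ≤ 3 * s}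

/-- Along the polynomial graph of the level curve, the Hessian form is within δ of a polynomial w,
so it is O(s) on boundedly many intervals. Points with equal labels belong to the same interval,
where the curve can leave its tangent line of direction (−a, 1) only by O(s). -/
theorem Hyp.exists_label (hφ : Hyp M φ) (hM : 10 ≤ M) {a : ℝ} (ha : |a| ≤ 1 / 10000)
    {h δ s G₀ : ℝ} (hh0 : 0 < h) (hh : h ≤ 1 / 100) (hδs : 1000 * δ ≤ s)
    (hδh : 10000 * δ ≤ h) (hη : 5 * (M * (2 * h) ^ (M - 2)) ≤ δ) (hhM : h ^ M ≤ δ)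
    {z₀ : ℝ × ℝ} (hz₀ : z₀ ∈ levelSet φ a G₀ δ s) :
    ∃ lab : ℝ × ℝ → ℕ, (∀ z, lab z ≤ labelBound M) ∧
      ∀ z₁ ∈ levelSet φ a G₀ δ s, |z₁.2 - z₀.2| ≤ h →
      ∀ z₂ ∈ levelSet φ a G₀ δ s, |z₂.2 - z₀.2| ≤ h → lab z₁ = lab z₂ →
        |z₂.1 - z₁.1 + a * (z₂.2 - z₁.2)| ≤ s ∧
        ∀ z ∈ segment ℝ z₁ z₂, |hessDir φ a z| ≤ 8 * s := by
  have hsq := mem_sq.1 hz₀.1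
  have hδ0 : 0 < δ := lt_of_lt_of_le (by positivity) hhM
  have hbox : |z₀.1| + 2 * h < 2 ∧ |z₀.2| + 2 * h < 2 := ⟨by linarith, by linarith⟩
  have hU : ∀ {x y : ℝ}, |x - z₀.1| ≤ 2 * h → |y - z₀.2| ≤ 2 * h → (x, y) ∈ interior sq2 :=
    fun hx hy => near_mem_U hz₀.1 (ρ := 2 * h) (by linarith) hx hy
  -- After M iterations the residual is at most h^M · h/20 + 4δ ≤ 5δ.
  obtain ⟨γ, hγd, hγ⟩ := hφ.exists_newton hM ha hz₀.1 hh0 hh (by linarith)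
    (hφ.polyApprox_lev hM (by linarith) hbox (by linarith)) (G₀ := G₀)
    (hz₀.2.1.trans (by linarith)) M
  have hγ1 : ∀ y, |y - z₀.2| ≤ h → |γ.eval y - z₀.1| ≤ h := fun y hy => (hγ y hy).1
  have hγ2 : ∀ y, |y - z₀.2| ≤ h → |lev φ a (γ.eval y, y) - G₀| ≤ 5 * δ := fun y hy => by
    refine (hγ y hy).2.trans ?_
    have : h ^ M * (h / 20) ≤ δ * 1 := mul_le_mul hhM (by linarith) (by positivity) hδ0.le
    linarith
  obtain ⟨g, hg⟩ := hφ.polyApprox_hessDir hM (a := a) (by linarith) hbox (by linarith)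
  set w := substPoly (M - 2) g z₀ γ with hw
  have hw1 : ∀ y, |y - z₀.2| ≤ h → |hessDir φ a (γ.eval y, y) - w.eval y| ≤ δ := fun y hy => by
    rw [hw, eval_substPoly]
    exact (hg (γ.eval y, y) (by linarith [hγ1 y hy]) (by linarith)).trans hη
  -- q is negative exactly where |w| < 4s; the gap between 4s and the 3s of `levelSet` pays for the
  -- errors O(δ). Its degree is at most twice that of w, whence `labelBound`.
  set q := w ^ 2 - Polynomial.C (16 * s ^ 2) with hq
  have hqd : q.natDegree ≤ labelBound M := by
    rw [hq, Polynomial.natDegree_sub_C]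
    refine Polynomial.natDegree_pow_le.trans (Nat.mul_le_mul_left _ ?_)
    refine (natDegree_substPoly_le _ _ _ _).trans (Nat.mul_le_mul_left _ (by omega))
  have hqe : ∀ y, q.eval y = (w.eval y) ^ 2 - 16 * s ^ 2 := fun y => by simp [hq]
  have hs0 : 0 < s := by linarith
  -- points of the level set lie close to the graph of `γ`
  have hx0 : ∀ z ∈ levelSet φ a G₀ δ s, |z.2 - z₀.2| ≤ h → |z.1 - z₀.1| ≤ h := fun z hz hy => by
    have hzU : z ∈ interior sq2 := by
      have := mem_sq.1 hz.1; rw [mem_U]; constructor <;> linarith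
    have hzU0 : z₀ ∈ interior sq2 := by rw [mem_U]; constructor <;> linarith
    have h1 := hφ.lev_near hM ha hzU0 hzU
    have h2 := abs_le.1 hz.2.1
    have h3 := abs_le.1 hz₀.2.1
    have h4 : |lev φ a z - lev φ a z₀| ≤ 120 * δ := by
      rw [abs_le]; constructor <;> linarith [h2.1, h2.2, h3.1, h3.2]
    have h5 := abs_sub (lev φ a z - lev φ a z₀) (lev φ a z - lev φ a z₀ - (z.1 - z₀.1))
    rw [sub_sub_cancel] at h5
    linarith [abs_nonneg (z.1 - z₀.1)]
  have hxγ : ∀ z ∈ levelSet φ a G₀ δ s, |z.2 - z₀.2| ≤ h → |z.1 - γ.eval z.2| ≤ 100 * δ :=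
    fun z hz hy => by
    have h1 := hx0 z hz hy
    have h2 := lev_close hφ hM ha (x := γ.eval z.2) (x' := z.1) (y := z.2)
      (hU (by linarith [hγ1 _ hy]) (by linarith)) (hU (by linarith) (by linarith))
    have h3 := abs_sub (lev φ a (z.1, z.2) - G₀) (lev φ a (γ.eval z.2, z.2) - G₀)
    rw [sub_sub_sub_cancel_right] at h3
    have h4 := hγ2 _ hy
    have h5 : |lev φ a (z.1, z.2) - G₀| ≤ 60 * δ := hz.2.1
    linarith
  have hqneg : ∀ z ∈ levelSet φ a G₀ δ s, |z.2 - z₀.2| ≤ h → q.eval z.2 < 0 := fun z hz hy => by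
    have h1 := hxγ z hz hy
    have h2 := hφ.lip_hessDir hM ha (z := (z.1, z.2)) (z' := (γ.eval z.2, z.2))
      (hU (by linarith [hx0 z hz hy]) (by linarith)) (hU (by linarith [hγ1 _ hy]) (by linarith))
    simp only [sub_self, abs_zero, add_zero] at h2
    rw [abs_sub_comm] at h1
    have h3 := abs_le.1 (hw1 _ hy)
    have h4 := abs_le.1 hz.2.2
    have h5 : |hessDir φ a (γ.eval z.2, z.2) - hessDir φ a (z.1, z.2)| ≤ δ := by linarith
    rw [abs_le] at h5
    rw [hqe]
    have h6 : |w.eval z.2| < 4 * s := by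
      rw [abs_lt]; constructor <;> linarith [h3.1, h3.2, h4.1, h4.2, h5.1, h5.2]
    have h7 := sq_lt_sq' (abs_lt.1 h6).1 (abs_lt.1 h6).2
    linarith
  -- The label counts the distinct roots of q below the height of the point.
  refine ⟨fun z => (q.roots.toFinset.filter (· < z.2)).card, fun z => ?_, ?_⟩
  · exact (Finset.card_filter_le _ _).trans
      ((Multiset.toFinset_card_le _).trans ((Polynomial.card_roots' q).trans hqd))
  have key : ∀ z₁ ∈ levelSet φ a G₀ δ s, |z₁.2 - z₀.2| ≤ h →
      ∀ z₂ ∈ levelSet φ a G₀ δ s, |z₂.2 - z₀.2| ≤ h → z₁.2 ≤ z₂.2 →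
      (q.roots.toFinset.filter (· < z₁.2)).card = (q.roots.toFinset.filter (· < z₂.2)).card →
        |z₂.1 - z₁.1 + a * (z₂.2 - z₁.2)| ≤ s ∧
        ∀ z ∈ segment ℝ z₁ z₂, |hessDir φ a z| ≤ 8 * s := by
    intro z₁ hz₁ hy₁ z₂ hz₂ hy₂ h12 hlab
    have hy : ∀ y ∈ Icc z₁.2 z₂.2, |y - z₀.2| ≤ h := fun y hy => by
      rw [abs_le] at *; constructor <;> linarith [hy.1, hy.2, hy₁.1, hy₂.2]
    have hwy : ∀ y ∈ Icc z₁.2 z₂.2, |w.eval y| ≤ 4 * s := by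
      intro y hyI
      by_contra hcon
      have hqy : 0 ≤ q.eval y := by
        rw [hqe]
        have := sq_le_sq' (a := 4 * s) (b := |w.eval y|) (by linarith) (by linarith)
        rw [sq_abs] at this
        linarith
      -- If |w| exceeded 4s in between, q would change sign after z₁ and produce a root below the
      -- height of z₂ but not below that of z₁, so the labels would differ.
      have hIVT := intermediate_value_Icc hyI.1 (q.continuous.continuousOn (s := Icc z₁.2 y))
      obtain ⟨r, hr, hr0⟩ := hIVT ⟨(hqneg z₁ hz₁ hy₁).le, hqy⟩
      have hr2 : r ≠ z₂.2 := fun e => by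
        have := hqneg z₂ hz₂ hy₂
        rw [← e] at this
        exact absurd hr0 this.ne
      have hq0 : q ≠ 0 := fun e => by
        have := hqneg z₁ hz₁ hy₁
        rw [e, Polynomial.eval_zero] at this
        exact lt_irrefl _ this
      have hss : q.roots.toFinset.filter (· < z₁.2) ⊂ q.roots.toFinset.filter (· < z₂.2) := by
        rw [Finset.ssubset_iff_of_subset]
        · refine ⟨r, ?_, ?_⟩
          · simp only [Finset.mem_filter, Multiset.mem_toFinset, Polynomial.mem_roots hq0]
            exact ⟨hr0, lt_of_le_of_ne (hr.2.trans hyI.2) hr2⟩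
          · simp only [Finset.mem_filter, not_and, not_lt]
            exact fun _ => hr.1
        · intro t ht
          rw [Finset.mem_filter] at ht ⊢
          exact ⟨ht.1, ht.2.trans_le h12⟩
      exact absurd hlab (Finset.card_lt_card hss).ne
    have hW : ∀ y ∈ Icc z₁.2 z₂.2, |hessDir φ a (γ.eval y, y)| ≤ 5 * s := fun y hyI => by
      have h1 := abs_add_le (hessDir φ a (γ.eval y, y) - w.eval y) (w.eval y)
      rw [sub_add_cancel] at h1
      linarith [hw1 y (hy y hyI), hwy y hyI]
    -- the tangent line at `z₁`
    set ℓ : ℝ → ℝ := fun y => z₁.1 - a * (y - z₁.2) with hℓ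
    have hℓ0 : ∀ y ∈ Icc z₁.2 z₂.2, |ℓ y - z₀.1| ≤ 2 * h := fun y hyI => by
      have h1 := hx0 z₁ hz₁ hy₁
      have h2 : |a * (y - z₁.2)| ≤ 1 / 10000 * (2 * h) := by
        rw [abs_mul]
        refine mul_le_mul ha ?_ (abs_nonneg _) (by norm_num)
        rw [abs_of_nonneg (by linarith [hyI.1])]
        linarith [(abs_le.1 hy₁).1, (abs_le.1 hy₂).2, hyI.2]
      have e : ℓ y - z₀.1 = (z₁.1 - z₀.1) - a * (y - z₁.2) := by rw [hℓ]; ring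
      rw [e]
      exact (abs_sub _ _).trans (by linarith)
    have hcont : ContinuousOn (fun y => |γ.eval y - ℓ y|) (Icc z₁.2 z₂.2) := by
      refine (Continuous.abs ?_).continuousOn
      exact γ.continuous.sub (by fun_prop)
    obtain ⟨ym, hym, hmax⟩ := isCompact_Icc.exists_isMaxOn (nonempty_Icc.2 h12) hcont
    set m' := |γ.eval ym - ℓ ym| with hm'
    have hmax' : ∀ y ∈ Icc z₁.2 z₂.2, |γ.eval y - ℓ y| ≤ m' := fun y hyI => hmax hyI
    have hWℓ : ∀ y ∈ Icc z₁.2 z₂.2, |hessDir φ a (ℓ y, y)| ≤ 5 * s + 1 / 10000 * m' :=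
      fun y hyI => by
      have h1 := hφ.lip_hessDir hM ha (z := (γ.eval y, y)) (z' := (ℓ y, y))
        (hU (by linarith [hγ1 _ (hy y hyI)]) (by linarith [hy y hyI]))
        (hU (hℓ0 y hyI) (by linarith [hy y hyI]))
      simp only [sub_self, abs_zero, add_zero] at h1
      rw [abs_sub_comm (ℓ y)] at h1
      have h2 := abs_add_le (hessDir φ a (ℓ y, y) - hessDir φ a (γ.eval y, y))
        (hessDir φ a (γ.eval y, y))
      rw [sub_add_cancel] at h2
      linarith [hW y hyI, hmax' y hyI]
    -- Bootstrap: the Hessian form on the tangent line is at most 5s + m'/10000, so `lev` drifts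
    -- along it by at most 2h times this. Since the horizontal slope of `lev` is near 1, m' is
    -- bounded by O(δ + hs) plus a small multiple of itself, which is absorbed.
    have hmle : m' ≤ s / 4 := by
      have el : ∀ y, z₁ + (y - z₁.2) • (-a, (1 : ℝ)) = (ℓ y, y) := fun y => by
        ext
        · simp only [Prod.fst_add, Prod.smul_fst, smul_eq_mul, hℓ]; ring
        · simp only [Prod.snd_add, Prod.smul_snd, smul_eq_mul]; ring
      obtain ⟨θ, hθ, hline⟩ := hφ.lev_line hM a (z := z₁) (t := ym - z₁.2)
        (hU (by linarith [hx0 z₁ hz₁ hy₁]) (by linarith))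
        (by rw [el]; exact hU (hℓ0 ym hym) (by linarith [hy ym hym]))
      have e2 : z₁ + (θ * (ym - z₁.2)) • (-a, (1 : ℝ))
          = (ℓ (z₁.2 + θ * (ym - z₁.2)), z₁.2 + θ * (ym - z₁.2)) := by
        rw [← el, add_sub_cancel_left]
      have hyθ : z₁.2 + θ * (ym - z₁.2) ∈ Icc z₁.2 z₂.2 := by
        have h0 : 0 ≤ ym - z₁.2 := by linarith [hym.1]
        constructor
        · nlinarith [hθ.1]
        · nlinarith [hθ.2, hym.2]
      rw [el, e2] at hline
      have h1 := hWℓ _ hyθ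
      have h2 : |lev φ a (ℓ ym, ym) - lev φ a z₁| ≤ 2 * h * (5 * s + 1 / 10000 * m') := by
        rw [hline, abs_mul]
        refine mul_le_mul ?_ h1 (abs_nonneg _) (by linarith)
        rw [abs_of_nonneg (by linarith [hym.1])]
        linarith [(abs_le.1 hy₁).1, (abs_le.1 hy₂).2, hym.2]
      have h3 := lev_close hφ hM ha (x := ℓ ym) (x' := γ.eval ym) (y := ym)
        (hU (hℓ0 ym hym) (by linarith [hy ym hym]))
        (hU (by linarith [hγ1 _ (hy ym hym)]) (by linarith [hy ym hym]))
      have h4 := abs_le.1 (hγ2 ym (hy ym hym))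
      have h5 := abs_le.1 hz₁.2.1
      have h6 := abs_le.1 h2
      have h7 : |lev φ a (γ.eval ym, ym) - lev φ a (ℓ ym, ym)|
          ≤ 65 * δ + 2 * h * (5 * s + 1 / 10000 * m') := by
        rw [abs_le]; constructor <;> linarith [h4.1, h4.2, h5.1, h5.2, h6.1, h6.2]
      have hm0 : 0 ≤ m' := abs_nonneg _
      have h8 : 2 * h * (5 * s + 1 / 10000 * m') ≤ 1 / 50 * (5 * s + 1 / 10000 * m') := by
        refine mul_le_mul_of_nonneg_right (by linarith) (by linarith)
      have h9 : 9 / 10 * m' ≤ |lev φ a (γ.eval ym, ym) - lev φ a (ℓ ym, ym)| := h3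
      linarith
    have hend : |z₂.1 - z₁.1 + a * (z₂.2 - z₁.2)| ≤ s := by
      have h1 := hxγ z₂ hz₂ hy₂
      have h2 := hmax' z₂.2 ⟨h12, le_rfl⟩
      have e : z₂.1 - z₁.1 + a * (z₂.2 - z₁.2)
          = (z₂.1 - γ.eval z₂.2) + (γ.eval z₂.2 - ℓ z₂.2) := by rw [hℓ]; ring
      rw [e]
      exact (abs_add_le _ _).trans (by linarith)
    refine ⟨hend, fun z hz => ?_⟩
    rw [segment_eq_image'] at hz
    obtain ⟨θ, hθ, rfl⟩ := hz
    set y := z₁.2 + θ * (z₂.2 - z₁.2) with hydef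
    have hyI : y ∈ Icc z₁.2 z₂.2 := by
      have h0 : 0 ≤ z₂.2 - z₁.2 := by linarith
      constructor
      · rw [hydef]; nlinarith [hθ.1]
      · rw [hydef]; nlinarith [hθ.2]
    have ez : z₁ + θ • (z₂ - z₁) = (ℓ y + θ * (z₂.1 - z₁.1 + a * (z₂.2 - z₁.2)), y) := by
      ext
      · simp only [Prod.fst_add, Prod.smul_fst, Prod.fst_sub, smul_eq_mul, hℓ, hydef]; ring
      · simp only [Prod.snd_add, Prod.smul_snd, Prod.snd_sub, smul_eq_mul, hydef]
    have hzU : z₁ + θ • (z₂ - z₁) ∈ interior sq2 := by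
      refine convex_U.segment_subset (x := z₁) (y := z₂) ?_ ?_ ?_
      · exact hU (by linarith [hx0 z₁ hz₁ hy₁]) (by linarith)
      · exact hU (by linarith [hx0 z₂ hz₂ hy₂]) (by linarith)
      · rw [segment_eq_image']; exact ⟨θ, hθ, rfl⟩
    change |hessDir φ a (z₁ + θ • (z₂ - z₁))| ≤ 8 * s
    rw [ez] at hzU ⊢
    have h1 := hφ.lip_hessDir hM ha (z := (ℓ y, y)) (hU (hℓ0 y hyI) (by linarith [hy y hyI])) hzU
    simp only [sub_self, abs_zero, add_zero, add_sub_cancel_left] at h1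
    have h2 : |θ * (z₂.1 - z₁.1 + a * (z₂.2 - z₁.2))| ≤ 1 * s := by
      rw [abs_mul, abs_of_nonneg hθ.1]
      exact mul_le_mul hθ.2 hend (abs_nonneg _) zero_le_one
    have h3 := hWℓ y hyI
    have h4 := abs_sub_abs_le_abs_sub
      (hessDir φ a (ℓ y + θ * (z₂.1 - z₁.1 + a * (z₂.2 - z₁.2)), y)) (hessDir φ a (ℓ y, y))
    linarith
  intro z₁ hz₁ hy₁ z₂ hz₂ hy₂ hlab
  rcases le_total z₁.2 z₂.2 with h12 | h12
  · exact key z₁ hz₁ hy₁ z₂ hz₂ hy₂ h12 hlab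
  · obtain ⟨k1, k2⟩ := key z₂ hz₂ hy₂ z₁ hz₁ hy₁ h12 hlab.symm
    refine ⟨?_, by rwa [segment_symm]⟩
    rw [← abs_neg]
    convert k1 using 2
    ring

/-! ### Coordinates adapted to a direction, strips and their divisions -/

/-- The coordinate `⟨z, perp a⟩` of `z` across `dir a`. -/
def pcoord (a : ℝ) (z : ℝ × ℝ) : ℝ := z.1 * (perp a).1 + z.2 * (perp a).2

theorem sqrt_one_add_sq_pos (a : ℝ) : 0 < √(1 + a ^ 2) := Real.sqrt_pos.2 (by positivity)

theorem inv_sqrt_sq (a : ℝ) : (√(1 + a ^ 2))⁻¹ ^ 2 * (1 + a ^ 2) = 1 := by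
  rw [inv_pow, Real.sq_sqrt (by positivity)]
  exact inv_mul_cancel₀ (by positivity)

theorem inv_sqrt_le_one (a : ℝ) : (√(1 + a ^ 2))⁻¹ ≤ 1 :=
  inv_le_one_of_one_le₀ (Real.one_le_sqrt.2 (by nlinarith [sq_nonneg a]))

theorem coord_eq (a : ℝ) (z : ℝ × ℝ) : coord a z = (√(1 + a ^ 2))⁻¹ * (z.2 - a * z.1) := by
  simp only [coord, dir, Prod.smul_mk, smul_eq_mul]; ring

theorem pcoord_eq (a : ℝ) (z : ℝ × ℝ) : pcoord a z = (√(1 + a ^ 2))⁻¹ * (z.1 + a * z.2) := by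
  simp only [pcoord, perp, Prod.smul_mk, smul_eq_mul]; ring

theorem coord_add (a : ℝ) (z z' : ℝ × ℝ) : coord a (z + z') = coord a z + coord a z' := by
  simp only [coord, Prod.fst_add, Prod.snd_add]; ring

theorem pcoord_add (a : ℝ) (z z' : ℝ × ℝ) : pcoord a (z + z') = pcoord a z + pcoord a z' := by
  simp only [pcoord, Prod.fst_add, Prod.snd_add]; ring

theorem coord_smul (a t : ℝ) (z : ℝ × ℝ) : coord a (t • z) = t * coord a z := by
  simp only [coord, Prod.smul_fst, Prod.smul_snd, smul_eq_mul]; ring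

theorem pcoord_smul (a t : ℝ) (z : ℝ × ℝ) : pcoord a (t • z) = t * pcoord a z := by
  simp only [pcoord, Prod.smul_fst, Prod.smul_snd, smul_eq_mul]; ring

theorem coord_dir (a : ℝ) : coord a (dir a) = 1 := by
  rw [coord_eq]
  simp only [dir, Prod.smul_mk, smul_eq_mul]
  linear_combination inv_sqrt_sq a

theorem coord_perp (a : ℝ) : coord a (perp a) = 0 := by
  rw [coord_eq]
  simp only [perp, Prod.smul_mk, smul_eq_mul]
  ring

theorem pcoord_dir (a : ℝ) : pcoord a (dir a) = 0 := by
  rw [pcoord_eq]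
  simp only [dir, Prod.smul_mk, smul_eq_mul]
  ring

theorem pcoord_perp (a : ℝ) : pcoord a (perp a) = 1 := by
  rw [pcoord_eq]
  simp only [perp, Prod.smul_mk, smul_eq_mul]
  linear_combination inv_sqrt_sq a

theorem coord_add_dir (a t : ℝ) (z : ℝ × ℝ) : coord a (z + t • dir a) = coord a z + t := by
  rw [coord_add, coord_smul, coord_dir, mul_one]

theorem pcoord_add_dir (a t : ℝ) (z : ℝ × ℝ) : pcoord a (z + t • dir a) = pcoord a z := by
  rw [pcoord_add, pcoord_smul, pcoord_dir, mul_zero, add_zero]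

theorem coord_add_perp (a t : ℝ) (z : ℝ × ℝ) : coord a (z + t • perp a) = coord a z := by
  rw [coord_add, coord_smul, coord_perp, mul_zero, add_zero]

theorem eq_of_coords {a : ℝ} {z z' : ℝ × ℝ} (h : coord a z = coord a z')
    (hp : pcoord a z = pcoord a z') : z = z' := by
  rw [coord_eq, coord_eq, mul_right_inj' (inv_ne_zero (sqrt_one_add_sq_pos a).ne')] at h
  rw [pcoord_eq, pcoord_eq, mul_right_inj' (inv_ne_zero (sqrt_one_add_sq_pos a).ne')] at hp
  have h1 : 1 + a ^ 2 ≠ 0 := by positivity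
  ext
  · have : (1 + a ^ 2) * z.1 = (1 + a ^ 2) * z'.1 := by linear_combination hp - a * h
    exact mul_left_cancel₀ h1 this
  · have : (1 + a ^ 2) * z.2 = (1 + a ^ 2) * z'.2 := by linear_combination h + a * hp
    exact mul_left_cancel₀ h1 this

theorem mem_strip {a w : ℝ} {j : ℤ} {z : ℝ × ℝ} :
    z ∈ strip a w j ↔ pcoord a z ∈ Icc (((j : ℝ) - 1) * w) (((j : ℝ) + 1) * w) := by
  constructor
  · rintro ⟨u, hu, t, rfl⟩
    rwa [pcoord_add_dir, pcoord_smul, pcoord_perp, mul_one]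
  · intro h
    refine ⟨pcoord a z, h, coord a z, eq_of_coords (a := a) ?_ ?_⟩
    · rw [coord_add_dir, coord_smul, coord_perp, mul_zero, zero_add]
    · rw [pcoord_add_dir, pcoord_smul, pcoord_perp, mul_one]

theorem abs_mul_le_of_le_one {c x : ℝ} (h0 : 0 ≤ c) (h : c ≤ 1) : |c * x| ≤ |x| := by
  rw [abs_mul, abs_of_nonneg h0]
  exact mul_le_of_le_one_left (abs_nonneg _) h

theorem abs_coord_sub_le {a : ℝ} (ha : |a| ≤ 1) (z z' : ℝ × ℝ) :
    |coord a z' - coord a z| ≤ |z'.1 - z.1| + |z'.2 - z.2| := by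
  have e : coord a z' - coord a z
      = (√(1 + a ^ 2))⁻¹ * ((z'.2 - z.2) - a * (z'.1 - z.1)) := by
    rw [coord_eq, coord_eq]; ring
  rw [e]
  refine (abs_mul_le_of_le_one (by positivity) (inv_sqrt_le_one a)).trans ?_
  refine (abs_sub _ _).trans ?_
  rw [abs_mul]
  nlinarith [abs_nonneg (z'.1 - z.1)]

theorem abs_pcoord_sub_le (a : ℝ) (z z' : ℝ × ℝ) :
    |pcoord a z' - pcoord a z| ≤ |z'.1 - z.1 + a * (z'.2 - z.2)| := by
  have e : pcoord a z' - pcoord a z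
      = (√(1 + a ^ 2))⁻¹ * (z'.1 - z.1 + a * (z'.2 - z.2)) := by
    rw [pcoord_eq, pcoord_eq]; ring
  rw [e]
  exact abs_mul_le_of_le_one (by positivity) (inv_sqrt_le_one a)

/-- Sliding along `dir a` preserves `pcoord`, and sliding along `perp a` preserves `coord`, so
membership separates into a condition on each coordinate. -/
theorem mem_strip1 {φ : ℝ × ℝ → ℝ} {a r w s : ℝ} {j : ℤ} {z : ℝ × ℝ} :
    z ∈ strip1 φ a r w s j ↔
      z ∈ strip a w j ∧ ∃ p ∈ strip a w j ∩ region φ a r, |coord a z - coord a p| ≤ s := by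
  constructor
  · rintro ⟨p, ⟨hp, v, hv⟩, ρ, hρ, rfl⟩
    refine ⟨?_, _, hv, ?_⟩
    · rw [mem_strip] at hp ⊢; rwa [pcoord_add_dir]
    · rw [coord_add_dir, coord_add_perp, add_sub_cancel_left]; exact abs_le.2 hρ
  · rintro ⟨hz, p, hp, hs⟩
    refine ⟨z + (coord a p - coord a z) • dir a, ⟨?_, ?_⟩, coord a z - coord a p, abs_le.1 hs, ?_⟩
    · rw [mem_strip] at hz ⊢; rwa [pcoord_add_dir]
    · refine ⟨pcoord a p - pcoord a z, ?_⟩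
      convert hp using 1
      refine eq_of_coords (a := a) ?_ ?_
      · rw [coord_add_perp, coord_add_dir]; ring
      · rw [pcoord_add, pcoord_add_dir, pcoord_smul, pcoord_perp]; ring
    · rw [add_assoc, ← add_smul]; simp

theorem abs_coord_sub_segment_le {a : ℝ} {z q u : ℝ × ℝ} (hu : u ∈ segment ℝ z q) :
    |coord a u - coord a z| ≤ |coord a q - coord a z| := by
  rw [segment_eq_image'] at hu
  obtain ⟨θ, hθ, rfl⟩ := hu
  have e : coord a (z + θ • (q - z)) - coord a z = θ * (coord a q - coord a z) := by
    rw [coord_add, coord_smul, sub_eq_add_neg q, coord_add, ← neg_one_smul ℝ z, coord_smul]; ring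
  change |coord a (z + θ • (q - z)) - coord a z| ≤ _
  rw [e]
  exact abs_mul_le_of_le_one hθ.1 hθ.2

theorem convex_strip (a w : ℝ) (j : ℤ) : Convex ℝ (strip a w j) := by
  intro z hz q hq α β hα hβ hαβ
  rw [mem_strip] at *
  rw [pcoord_add, pcoord_smul, pcoord_smul]
  exact convex_Icc _ _ hz hq hα hβ hαβ

theorem exists_mem_Icc_succ {t : ℕ → ℝ} {c : ℝ} {n : ℕ} (hn : n ≠ 0) (h0 : t 0 ≤ c)
    (hc : c ≤ t n) : ∃ i < n, c ∈ Icc (t i) (t (i + 1)) := by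
  induction n with
  | zero => exact absurd rfl hn
  | succ n ih =>
    rcases le_total (t n) c with h | h
    · exact ⟨n, n.lt_succ_self, h, hc⟩
    · rcases Nat.eq_zero_or_pos n with rfl | hn'
      · exact ⟨0, Nat.one_pos, h0, hc⟩
      · obtain ⟨i, hi, h'⟩ := ih hn'.ne' h
        exact ⟨i, hi.trans n.lt_succ_self, h'⟩

theorem sub_le_mul_of_step_le {t : ℕ → ℝ} {b : ℝ} {n i j : ℕ}
    (h : ∀ i < n, t (i + 1) - t i ≤ b) (hij : i ≤ j) (hj : j ≤ n) :
    t j - t i ≤ ((j : ℝ) - i) * b := by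
  induction j, hij using Nat.le_induction with
  | base => simp
  | succ j hij ih =>
    have h1 := ih (by omega)
    have h2 := h j (by omega)
    push_cast
    linarith

theorem mono_of_step_nonneg {t : ℕ → ℝ} {n i j : ℕ}
    (h : ∀ i < n, 0 ≤ t (i + 1) - t i) (hij : i ≤ j) (hj : j ≤ n) : t i ≤ t j := by
  induction j, hij using Nat.le_induction with
  | base => exact le_rfl
  | succ j hij ih => linarith [ih (by omega), h j (by omega)]

/-- A division of an interval into as few pieces of length at most `b` as possible has at most
three pieces that meet a given interval shorter than `b`. -/
theorem index_le_add_two {t : ℕ → ℝ} {b c c' : ℝ} {n i j : ℕ}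
    (h0 : ∀ i < n, 0 ≤ t (i + 1) - t i) (hb : ∀ i < n, t (i + 1) - t i ≤ b)
    (hn : ((n : ℝ) - 1) * b < t n - t 0) (hc : |c' - c| < b) (hj : j < n)
    (hci : c ≤ t (i + 1)) (hcj : t j ≤ c') : j ≤ i + 2 := by
  -- If j ≥ i + 3, the pieces up to index i and those from i + 3 on number n − 2 and have total
  -- length at most (n − 2)b, while the gap between them is shorter than b. The whole would be
  -- shorter than (n − 1)b, against the minimality of n.
  by_contra! hij
  have h1 := sub_le_mul_of_step_le hb (i := 0) (j := i + 1) (by omega) (by omega)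
  have h2 := sub_le_mul_of_step_le hb (i := i + 3) (j := n) (by omega) le_rfl
  have h3 := mono_of_step_nonneg h0 (i := i + 3) (j := j) (by omega) hj.le
  have h4 := (abs_lt.1 hc).2
  push_cast at h1 h2
  linarith

/-- The grid direction A_k nearest to a is within Cs/2 of it, so |A − A_k| ≤ 8s + Cs/2 < Cs on every
segment joining points of S; this is the use of C > 16. These segments put S into one connected
component, and at most three pieces of its division meet S, since S is shorter than b. The final
lengthening by s catches the neighbourhoods. -/
theorem IsStripFamily.exists_cover {φ : ℝ × ℝ → ℝ} {a₀ C w s b : ℝ} {𝓛 : Set (Set (ℝ × ℝ))}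
    (h𝓛 : IsStripFamily φ a₀ (C * s) w s b 𝓛) (hC : 16 < C) (hs : 0 < s) (hs1 : C * s ≤ 1)
    (hw : (C + 4) * s ≤ w) {a : ℝ} (ha : |a| ≤ 1 / 2) {S : Set (ℝ × ℝ)} (hS : S ⊆ sq)
    (hb : ∀ z₁ ∈ S, ∀ z₂ ∈ S, |z₂.1 - z₁.1| + |z₂.2 - z₁.2| < b)
    (hy : ∀ z₁ ∈ S, ∀ z₂ ∈ S, |z₂.2 - z₁.2| ≤ 1)
    (hline : ∀ z₁ ∈ S, ∀ z₂ ∈ S, |z₂.1 - z₁.1 + a * (z₂.2 - z₁.2)| ≤ s)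
    (hA : ∀ z₁ ∈ S, ∀ z₂ ∈ S, ∀ z ∈ segment ℝ z₁ z₂, |coefA φ z - a| ≤ 8 * s) :
    ∃ 𝓛₀ ⊆ 𝓛, 𝓛₀.Finite ∧ 𝓛₀.ncard ≤ 3 ∧
      ∀ z ∈ S, ∃ L ∈ 𝓛₀, ∀ u : ℝ × ℝ, |u.1 - z.1| + |u.2 - z.2| ≤ s → u ∈ L := by
  rcases S.eq_empty_or_nonempty with rfl | ⟨z₀, hz₀⟩
  · exact ⟨∅, empty_subset _, finite_empty, by simp, by simp⟩
  obtain ⟨P, hP, rfl⟩ := h𝓛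
  have hr0 : 0 < C * s := by positivity
  have hw0 : 0 < w := lt_of_lt_of_le (by positivity) hw
  set k := round ((a - a₀) / (C * s)) with hk
  set A := a₀ + k * (C * s) with hAdef
  have hAa : |a - A| ≤ C * s / 2 := by
    have h1 := abs_sub_round ((a - a₀) / (C * s))
    have e : a - A = ((a - a₀) / (C * s) - round ((a - a₀) / (C * s))) * (C * s) := by
      rw [hAdef, hk]; field_simp; ring
    rw [e, abs_mul, abs_of_pos hr0]
    nlinarith
  have hA1 : |A| ≤ 1 := by
    have := abs_sub_abs_le_abs_sub A a
    rw [abs_sub_comm] at this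
    linarith
  set j := round (pcoord A z₀ / w) with hj
  have hj0 : |pcoord A z₀ - j * w| ≤ w / 2 := by
    have h1 := abs_sub_round (pcoord A z₀ / w)
    have e : pcoord A z₀ - j * w = (pcoord A z₀ / w - round (pcoord A z₀ / w)) * w := by
      rw [← hj]; field_simp
    rw [e, abs_mul, abs_of_pos hw0]
    nlinarith
  -- z₀ lies within w/2 of the axis of the chosen strip. The other half of w has to hold s for the
  -- thickness of S, Cs/2 for the tilt of A_k against a, and s for the neighbourhood: together (C +
  -- 4)s/2.
  have hstrip : ∀ z ∈ S, ∀ u : ℝ × ℝ, |u.1 - z.1| + |u.2 - z.2| ≤ s → u ∈ strip A w j := by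
    intro z hz u hu
    rw [mem_strip, mem_Icc]
    have h1 := abs_pcoord_sub_le A z₀ z
    have h2 := abs_pcoord_sub_le A z u
    have h3 : |z.1 - z₀.1 + A * (z.2 - z₀.2)| ≤ s + C * s / 2 := by
      have e : z.1 - z₀.1 + A * (z.2 - z₀.2)
          = (z.1 - z₀.1 + a * (z.2 - z₀.2)) - (a - A) * (z.2 - z₀.2) := by ring
      rw [e]
      refine (abs_sub _ _).trans (add_le_add (hline z₀ hz₀ z hz) ?_)
      rw [abs_mul]
      calc _ ≤ C * s / 2 * 1 := mul_le_mul hAa (hy z₀ hz₀ z hz) (abs_nonneg _) (by positivity)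
        _ = _ := mul_one _
    have h4 : |u.1 - z.1 + A * (u.2 - z.2)| ≤ s := by
      refine (abs_add_le _ _).trans ?_
      rw [abs_mul]
      nlinarith [abs_nonneg (u.2 - z.2)]
    have h5 := abs_le.1 (h1.trans h3)
    have h6 := abs_le.1 (h2.trans h4)
    have h7 := abs_le.1 hj0
    constructor <;> linarith [h5.1, h5.2, h6.1, h6.2, h7.1, h7.2]
  have hstripS : ∀ z ∈ S, z ∈ strip A w j := fun z hz => hstrip z hz z (by simp [hs.le])
  set T := strip1 φ A (C * s) w s j with hT
  have hsegreg : ∀ z₁ ∈ S, ∀ z₂ ∈ S, ∀ z ∈ segment ℝ z₁ z₂,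
      z ∈ strip A w j ∩ region φ A (C * s) := fun z₁ hz₁ z₂ hz₂ z hz => by
    refine ⟨(convex_strip A w j).segment_subset (hstripS z₁ hz₁) (hstripS z₂ hz₂) hz,
      convex_sq.segment_subset (hS hz₁) (hS hz₂) hz, ?_⟩
    have h1 := hA z₁ hz₁ z₂ hz₂ z hz
    have h2 := abs_add_le (coefA φ z - a) (a - A)
    rw [sub_add_sub_cancel] at h2
    nlinarith
  have hregT : strip A w j ∩ region φ A (C * s) ⊆ T := fun z hz =>
    mem_strip1.2 ⟨hz.1, z, hz, by simp [hs.le]⟩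
  have hz₀T : z₀ ∈ T := hregT (hsegreg z₀ hz₀ z₀ hz₀ z₀ (left_mem_segment ℝ z₀ z₀))
  set E := connectedComponentIn T z₀ with hE
  have hSE : ∀ z ∈ S, z ∈ E := fun z hz =>
    (convex_segment z₀ z).isPreconnected.subset_connectedComponentIn (left_mem_segment ℝ z₀ z)
      (fun u hu => hregT (hsegreg z₀ hz₀ z hz u hu)) (right_mem_segment ℝ z₀ z)
  have hnear : ∀ z ∈ S, ∀ q ∈ strip A w j, |coord A q - coord A z| ≤ s → q ∈ E := by
    intro z hz q hq hqz
    rw [hE, connectedComponentIn_eq (hSE z hz)]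
    refine (convex_segment z q).isPreconnected.subset_connectedComponentIn
      (left_mem_segment ℝ z q) (fun u hu => ?_) (right_mem_segment ℝ z q)
    exact mem_strip1.2 ⟨(convex_strip A w j).segment_subset (hstripS z hz) hq hu, z,
      hsegreg z hz z hz z (left_mem_segment ℝ z z), (abs_coord_sub_segment_le hu).trans hqz⟩
  obtain ⟨n, t, hn, ht0, htn, hst, hPE⟩ := hP k j z₀ hz₀T
  have hbdd : ∀ q ∈ E, |coord A q| ≤ 2 + s := by
    intro q hq
    obtain ⟨-, p, hp, hqp⟩ := mem_strip1.1 (connectedComponentIn_subset T z₀ hq)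
    have hp2 := mem_sq.1 hp.2.1
    have h1 := abs_coord_sub_le hA1 0 p
    have h0 : coord A 0 = 0 := by simp [coord]
    rw [h0] at h1
    simp only [Prod.fst_zero, Prod.snd_zero, sub_zero] at h1
    have h2 := abs_add_le (coord A q - coord A p) (coord A p)
    rw [sub_add_cancel] at h2
    linarith
  have hlow : ∀ q ∈ E, t 0 ≤ coord A q := fun q hq => by
    rw [ht0]
    refine csInf_le ⟨-(2 + s), ?_⟩ (mem_image_of_mem _ hq)
    rintro _ ⟨q', hq', rfl⟩
    exact (abs_le.1 (hbdd q' hq')).1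
  have hupp : ∀ q ∈ E, coord A q ≤ t n := fun q hq => by
    rw [htn]
    refine le_csSup ⟨2 + s, ?_⟩ (mem_image_of_mem _ hq)
    rintro _ ⟨q', hq', rfl⟩
    exact (abs_le.1 (hbdd q' hq')).2
  have hlen : 0 < t n - t 0 := by
    have h1 : z₀ + s • dir A ∈ E := hnear z₀ hz₀ _ (by
      have := hstripS z₀ hz₀
      rw [mem_strip] at this ⊢
      rwa [pcoord_add_dir]) (by rw [coord_add_dir, add_sub_cancel_left, abs_of_pos hs])
    have h2 := hupp _ h1
    rw [coord_add_dir] at h2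
    linarith [hlow z₀ (hSE z₀ hz₀)]
  have hn0 : n ≠ 0 := by rintro rfl; simp at hlen
  have hb0 : 0 < b := by simpa using hb z₀ hz₀ z₀ hz₀
  have hnb : ((n : ℝ) - 1) * b < t n - t 0 := by
    rw [← htn, ← ht0] at hn
    have := Nat.ceil_lt_add_one (div_nonneg hlen.le hb0.le)
    rw [← hn] at this
    rw [← lt_div_iff₀ hb0]
    linarith
  set Q : ℕ → Set (ℝ × ℝ) := fun i => {z ∈ E | coord A z ∈ Icc (t i) (t (i + 1))} with hQ
  set I : Set ℕ := {i | i < n ∧ ∃ z ∈ S, coord A z ∈ Icc (t i) (t (i + 1))} with hI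
  have hSI : ∀ z ∈ S, ∃ i ∈ I, coord A z ∈ Icc (t i) (t (i + 1)) := fun z hz => by
    obtain ⟨i, hi, hc⟩ := exists_mem_Icc_succ hn0 (hlow z (hSE z hz)) (hupp z (hSE z hz))
    exact ⟨i, ⟨hi, z, hz, hc⟩, hc⟩
  have hIne : I.Nonempty := by obtain ⟨i, hi, -⟩ := hSI z₀ hz₀; exact ⟨i, hi⟩
  have hIsub : I ⊆ Finset.Icc (sInf I) (sInf I + 2) := by
    intro i hi
    rw [Finset.coe_Icc]
    refine ⟨Nat.sInf_le hi, ?_⟩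
    obtain ⟨-, z, hz, hcz⟩ := Nat.sInf_mem hIne
    obtain ⟨hin, z', hz', hcz'⟩ := hi
    exact index_le_add_two (fun i hi => hs.le.trans (hst i hi).1) (fun i hi => (hst i hi).2) hnb
      ((abs_coord_sub_le hA1 z z').trans_lt (hb z hz z' hz')) hin hcz.2 hcz'.1
  have hIfin : I.Finite := (Finset.finite_toSet _).subset hIsub
  refine ⟨(fun i => elongate A s (Q i)) '' I, ?_, hIfin.image _, ?_, ?_⟩
  · rintro _ ⟨i, hi, rfl⟩
    exact ⟨k, j, z₀, hz₀T, Q i, by rw [hPE]; exact ⟨i, hi.1, rfl⟩, rfl⟩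
  · refine (ncard_image_le hIfin).trans ((ncard_le_ncard hIsub (Finset.finite_toSet _)).trans ?_)
    rw [ncard_coe_finset, Nat.card_Icc]
    omega
  · intro z hz
    obtain ⟨i, hi, hc⟩ := hSI z hz
    refine ⟨_, mem_image_of_mem _ hi, fun u hu => ?_⟩
    have hcu := (abs_coord_sub_le hA1 z u).trans hu
    -- u is slid along the strip to the cross-section of z, where it belongs to the same piece; the
    -- lengthening brings it back.
    have hcp : coord A (u + (coord A z - coord A u) • dir A) = coord A z := by
      rw [coord_add_dir]; ring
    refine ⟨u + (coord A z - coord A u) • dir A, ⟨hnear z hz _ ?_ ?_, ?_⟩,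
      coord A u - coord A z, abs_le.1 hcu, ?_⟩
    · have := hstrip z hz u hu
      rw [mem_strip] at this ⊢
      rwa [pcoord_add_dir]
    · rw [hcp, sub_self, abs_zero]; exact hs.le
    · rwa [hcp]
    · rw [add_assoc, ← add_smul]; simp

/-! ### Covering neighbourhoods of level curves -/

/-- The points of `S` are covered, together with their `s`-neighbourhoods, by at most `n` elements
of `𝓛`. -/
def PtCover (𝓛 : Set (Set (ℝ × ℝ))) (s : ℝ) (S : Set (ℝ × ℝ)) (n : ℕ) : Prop :=
  ∃ 𝓛₀ ⊆ 𝓛, 𝓛₀.Finite ∧ 𝓛₀.ncard ≤ n ∧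
    ∀ z ∈ S, ∃ L ∈ 𝓛₀, ∀ u : ℝ × ℝ, |u.1 - z.1| + |u.2 - z.2| ≤ s → u ∈ L

theorem PtCover.biUnion {𝓛 : Set (Set (ℝ × ℝ))} {s : ℝ} {S : ℕ → Set (ℝ × ℝ)} {n N : ℕ}
    (h : ∀ i < N, PtCover 𝓛 s (S i) n) : PtCover 𝓛 s {z | ∃ i < N, z ∈ S i} (N * n) := by
  induction N with
  | zero => exact ⟨∅, empty_subset _, finite_empty, by simp, by simp⟩
  | succ N ih =>
    obtain ⟨𝓐, hA, hAf, hAn, hAc⟩ := ih fun i hi => h i (by omega)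
    obtain ⟨𝓑, hB, hBf, hBn, hBc⟩ := h N N.lt_succ_self
    refine ⟨𝓐 ∪ 𝓑, union_subset hA hB, hAf.union hBf, ?_, ?_⟩
    · refine (ncard_union_le _ _).trans ?_
      rw [Nat.succ_mul]
      exact add_le_add hAn hBn
    · rintro z ⟨i, hi, hz⟩
      rcases Nat.lt_succ_iff_lt_or_eq.1 hi with hi | rfl
      · obtain ⟨L, hL, hu⟩ := hAc z ⟨i, hi, hz⟩
        exact ⟨L, Or.inl hL, hu⟩
      · obtain ⟨L, hL, hu⟩ := hBc z hz
        exact ⟨L, Or.inr hL, hu⟩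

theorem PtCover.mono {𝓛 : Set (Set (ℝ × ℝ))} {s : ℝ} {S S' : Set (ℝ × ℝ)} {n : ℕ}
    (h : PtCover 𝓛 s S n) (hS : S' ⊆ S) : PtCover 𝓛 s S' n := by
  obtain ⟨𝓐, hA, hAf, hAn, hAc⟩ := h
  exact ⟨𝓐, hA, hAf, hAn, fun z hz => hAc z (hS hz)⟩

/-- The relations between the scales that the covering argument uses: `δ` is the size of the caps,
`s` the tolerance for the directions, `h` the height of the slabs into which `Σ` is cut, `b` the
length of the strips, `w` their width, and `D` the distance beyond which caps determine a
direction. -/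
structure Scales (M : ℕ) (C h δ s b w D : ℝ) : Prop where
  h_pos : 0 < h
  h_le : h ≤ 1 / 100
  δ_le_s : 1000 * δ ≤ s
  δ_le_h : 10000 * δ ≤ h
  taylor : 5 * (M * (2 * h) ^ (M - 2)) ≤ δ
  newton : h ^ M ≤ δ
  C_gt : 16 < C
  Cs_le : C * s ≤ 1
  width : (C + 4) * s ≤ w
  piece : s + 2 * h < b
  far : 20000 * δ ≤ D
  sep : 300 * δ ≤ D * s

/-- The number of sets needed to cover a neighbourhood of a level curve. -/
def coverCount (M : ℕ) (h : ℝ) : ℕ := (⌊2 / h⌋₊ + 1) * ((labelBound M + 1) * 3)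

variable {C h δ s b w D : ℝ}

theorem Scales.δ_pos (H : Scales M C h δ s b w D) : 0 < δ :=
  lt_of_lt_of_le (pow_pos H.h_pos M) H.newton

theorem Scales.s_pos (H : Scales M C h δ s b w D) : 0 < s := by
  linarith [H.δ_pos, H.δ_le_s]

theorem sq_subset_U : sq ⊆ interior sq2 := fun z hz => by
  rw [mem_sq] at hz; rw [mem_U]; constructor <;> linarith

/-- The set is split by slab and by label; each class is nearly straight and is covered by three
strips. -/
theorem Hyp.levelSet_cover (hφ : Hyp M φ) (hM : 10 ≤ M) (H : Scales M C h δ s b w D) {a : ℝ}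
    (ha : |a| ≤ 1 / 10000) (G₀ : ℝ) {a₀ : ℝ} {𝓛 : Set (Set (ℝ × ℝ))}
    (h𝓛 : IsStripFamily φ a₀ (C * s) w s b 𝓛) :
    PtCover 𝓛 s (levelSet φ a G₀ δ s) (coverCount M h) := by
  have hh := H.h_pos
  -- As y + 1 runs over [0, 2], the indices are 0, …, ⌊2/h⌋, which accounts for the + 1 in
  -- `coverCount`.
  set S : ℕ → Set (ℝ × ℝ) := fun i => {z ∈ levelSet φ a G₀ δ s | ⌊(z.2 + 1) / h⌋₊ = i} with hS
  have hdiff : ∀ i, ∀ z ∈ S i, ∀ z' ∈ S i, |z'.2 - z.2| ≤ h := by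
    intro i z hz z' hz'
    have h0 : ∀ u ∈ S i, i * h ≤ u.2 + 1 ∧ u.2 + 1 < (i + 1) * h := fun u hu => by
      have h1 : 0 ≤ (u.2 + 1) / h :=
        div_nonneg (by linarith [(abs_le.1 (mem_sq.1 hu.1.1).2).1]) hh.le
      have h2 := (Nat.floor_eq_iff h1).1 hu.2
      rwa [le_div_iff₀ hh, div_lt_iff₀ hh] at h2
    have h1 := h0 z hz
    have h2 := h0 z' hz'
    rw [abs_le]; constructor <;> nlinarith [h1.1, h1.2, h2.1, h2.2]
  have hcov : ∀ i < ⌊2 / h⌋₊ + 1, PtCover 𝓛 s (S i) ((labelBound M + 1) * 3) := by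
    intro i _
    rcases (S i).eq_empty_or_nonempty with he | ⟨z₀, hz₀⟩
    · exact ⟨∅, empty_subset _, finite_empty, by simp, by simp [he]⟩
    obtain ⟨lab, hlab, hpair⟩ := hφ.exists_label hM ha hh H.h_le H.δ_le_s H.δ_le_h H.taylor
      H.newton hz₀.1
    have hp : ∀ l, ∀ z₁ ∈ {z ∈ S i | lab z = l}, ∀ z₂ ∈ {z ∈ S i | lab z = l},
        |z₂.1 - z₁.1 + a * (z₂.2 - z₁.2)| ≤ s ∧
        ∀ z ∈ segment ℝ z₁ z₂, |hessDir φ a z| ≤ 8 * s := fun l z₁ h₁ z₂ h₂ =>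
      hpair z₁ h₁.1.1 (hdiff i z₀ hz₀ z₁ h₁.1) z₂ h₂.1.1 (hdiff i z₀ hz₀ z₂ h₂.1)
        (h₁.2.trans h₂.2.symm)
    have hl : ∀ l < labelBound M + 1, PtCover 𝓛 s {z ∈ S i | lab z = l} 3 := by
      intro l _
      refine h𝓛.exists_cover H.C_gt H.s_pos H.Cs_le H.width (a := a) (by linarith)
        (fun z hz => hz.1.1.1) ?_ ?_ (fun z₁ h₁ z₂ h₂ => (hp l z₁ h₁ z₂ h₂).1) ?_
      · intro z₁ h₁ z₂ h₂
        have h3 := (hp l z₁ h₁ z₂ h₂).1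
        have h4 := hdiff i z₁ h₁.1 z₂ h₂.1
        have h5 := abs_sub (z₂.1 - z₁.1 + a * (z₂.2 - z₁.2)) (a * (z₂.2 - z₁.2))
        rw [add_sub_cancel_right, abs_mul] at h5
        have h6 : |a| * |z₂.2 - z₁.2| ≤ 1 * h :=
          mul_le_mul (by linarith) h4 (abs_nonneg _) zero_le_one
        linarith [H.piece]
      · intro z₁ h₁ z₂ h₂
        linarith [hdiff i z₁ h₁.1 z₂ h₂.1, H.h_le]
      · intro z₁ h₁ z₂ h₂ z hz
        have hzU : z ∈ interior sq2 :=
          sq_subset_U (convex_sq.segment_subset h₁.1.1.1 h₂.1.1.1 hz)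
        exact (hφ.abs_hessDir hM ha hzU).1.trans ((hp l z₁ h₁ z₂ h₂).2 z hz)
    exact (PtCover.biUnion hl).mono fun z hz => ⟨lab z, Nat.lt_succ_of_le (hlab z), hz, rfl⟩
  refine (PtCover.biUnion hcov).mono fun z hz => ⟨⌊(z.2 + 1) / h⌋₊, ?_, hz, rfl⟩
  refine Nat.lt_succ_of_le (Nat.floor_le_floor ?_)
  have := (abs_le.1 (mem_sq.1 hz.1).2).2
  gcongr
  linarith

/-! ### Families of caps without strong separation -/

/-- The caps with centres in `F` are covered by at most `n` elements of `𝓛`. -/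
def CapCover (K μ : ℝ) (𝓛 : Set (Set (ℝ × ℝ))) (F : Set (ℝ × ℝ)) (n : ℕ) : Prop :=
  ∃ 𝓛₀ ⊆ 𝓛, 𝓛₀.Finite ∧ 𝓛₀.ncard ≤ n ∧ ∀ c ∈ F, ∃ L ∈ 𝓛₀, cap K μ c ⊆ L

/-- The `ℓ¹` distance in the plane. -/
def l1 (p q : ℝ × ℝ) : ℝ := |q.1 - p.1| + |q.2 - p.2|

theorem l1_comm (p q : ℝ × ℝ) : l1 p q = l1 q p := by
  rw [l1, l1, abs_sub_comm p.1, abs_sub_comm p.2]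

theorem l1_triangle (p q r : ℝ × ℝ) : l1 p r ≤ l1 p q + l1 q r := by
  have h1 := abs_sub_le r.1 q.1 p.1
  have h2 := abs_sub_le r.2 q.2 p.2
  simp only [l1]; linarith

theorem t1_add (p x y z : ℝ × ℝ) : t1 φ p x z = t1 φ p x y + t1 φ p y z := by
  simp only [t1]; ring

theorem t2_add (p x y z : ℝ × ℝ) : t2 φ p x z = t2 φ p x y + t2 φ p y z := by
  simp only [t2]; ring

theorem abs_t1_comm (p x y : ℝ × ℝ) : |t1 φ p x y| = |t1 φ p y x| := by
  rw [← abs_neg]; congr 1; simp only [t1]; ring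

theorem abs_t2_comm (p x y : ℝ × ℝ) : |t2 φ p x y| = |t2 φ p y x| := by
  rw [← abs_neg]; congr 1; simp only [t2]; ring

theorem Hyp.t2_near (hφ : Hyp M φ) (hM : 10 ≤ M) {p z z' : ℝ × ℝ} (hp : p ∈ interior sq2)
    (hz : z ∈ interior sq2) (hz' : z' ∈ interior sq2) :
    |t2 φ p z z' - (z'.1 - z.1)| ≤ 1 / 1000 * l1 z z' := by
  rw [t2_eq]; exact hφ.lev_near hM (hφ.abs_coefA_le hM hp) hz hz'

theorem Hyp.t1_near (hφ : Hyp M φ) (hM : 10 ≤ M) {p z z' : ℝ × ℝ} (hp : p ∈ interior sq2)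
    (hz : z ∈ interior sq2) (hz' : z' ∈ interior sq2) :
    |t1 φ p z z' - (z'.2 - z.2)| ≤ 1 / 1000 * l1 z z' := by
  rw [hφ.t1_eq_t2_swap hM hp]
  refine (hφ.swap.t2_near hM (swap_mem_U hp) (swap_mem_U hz) (swap_mem_U hz')).trans_eq ?_
  simp only [l1, Prod.fst_swap, Prod.snd_swap]; ring

/-- t¹ controls the vertical and t² the horizontal displacement, whatever their base points.
Allowing two different base points is essential for the comparisons below. -/
theorem Hyp.l1_le_of_t1_t2 (hφ : Hyp M φ) (hM : 10 ≤ M) {p p' z z' : ℝ × ℝ}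
    (hp : p ∈ interior sq2) (hp' : p' ∈ interior sq2) (hz : z ∈ interior sq2)
    (hz' : z' ∈ interior sq2) {B : ℝ} (h1 : |t1 φ p z z'| ≤ B) (h2 : |t2 φ p' z z'| ≤ B) :
    l1 z z' ≤ 3 * B := by
  have h3 := hφ.t1_near hM hp hz hz'
  have h4 := hφ.t2_near hM hp' hz hz'
  have h5 := abs_sub (t1 φ p z z') (t1 φ p z z' - (z'.2 - z.2))
  have h6 := abs_sub (t2 φ p' z z') (t2 φ p' z z' - (z'.1 - z.1))
  rw [sub_sub_cancel] at h5 h6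
  have : 0 ≤ B := (abs_nonneg _).trans h1
  simp only [l1] at *
  linarith

/-- At a far pair, t¹ and t² are never both small, even at different base points; hence for (c₁, c)
the same form is small at both. It cannot be t¹: in the triangle c₁, c₂, c, additivity at a fixed
base point would make both forms small at (c₁, c₂) or at (c₁, c). -/
theorem Hyp.t2_of_far (hφ : Hyp M φ) (hM : 10 ≤ M) {F : Set (ℝ × ℝ)}
    (hFU : F ⊆ interior sq2) (hδ : 0 < δ)
    (hF : ∀ p ∈ F, ∀ q ∈ F, |t1 φ p p q| < 50 * δ ∨ |t2 φ p p q| < 50 * δ)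
    {c₁ c₂ c : ℝ × ℝ} (h₁ : c₁ ∈ F) (h₂ : c₂ ∈ F) (hc : c ∈ F)
    (hfar : 20000 * δ ≤ l1 c₁ c₂) (hfar' : 10000 * δ ≤ l1 c₁ c)
    (ht₁ : |t2 φ c₁ c₁ c₂| < 50 * δ) (ht₂ : |t2 φ c₂ c₁ c₂| < 50 * δ) :
    |t2 φ c₁ c₁ c| < 50 * δ ∧ |t2 φ c c₁ c| < 50 * δ := by
  have inc : ∀ {p p' z z' : ℝ × ℝ}, p ∈ F → p' ∈ F → z ∈ F → z' ∈ F →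
      10000 * δ ≤ l1 z z' → |t1 φ p z z'| ≤ 400 * δ → |t2 φ p' z z'| ≤ 400 * δ → False := by
    intro p p' z z' hp hp' hz hz' hl h1 h2
    have := hφ.l1_le_of_t1_t2 hM (hFU hp) (hFU hp') (hFU hz) (hFU hz') h1 h2
    linarith
  have hcc : |t1 φ c c₁ c| < 50 * δ ∨ |t2 φ c c₁ c| < 50 * δ := by
    rw [abs_t1_comm, abs_t2_comm]; exact hF c hc c₁ h₁
  have main : |t1 φ c₁ c₁ c| < 50 * δ → |t1 φ c c₁ c| < 50 * δ → False := by
    intro a1 a2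
    have hbig : |t1 φ c c c₂| ≤ 301 * δ → False := fun h => by
      refine inc hc h₁ h₁ h₂ (by linarith) ?_ (by linarith)
      rw [t1_add c c₁ c c₂]
      exact (abs_add_le _ _).trans (by linarith)
    rcases hF c hc c₂ h₂ with b1 | b1
    · exact hbig (by linarith)
    rcases hF c₂ h₂ c hc with b2 | b2
    · rw [abs_t1_comm] at b2
      have h3 := hφ.l1_le_of_t1_t2 hM (hFU h₂) (hFU hc) (hFU hc) (hFU h₂) b2.le b1.le
      have h4 := hφ.t1_near hM (hFU hc) (hFU hc) (hFU h₂)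
      have h5 := abs_add_le (t1 φ c c c₂ - (c₂.2 - c.2)) (c₂.2 - c.2)
      rw [sub_add_cancel] at h5
      have h6 : |c₂.2 - c.2| ≤ l1 c c₂ := le_add_of_nonneg_left (abs_nonneg _)
      exact hbig (by linarith)
    · refine inc h₁ h₂ h₁ hc hfar' (by linarith) ?_
      rw [t2_add c₂ c₁ c₂ c]
      exact (abs_add_le _ _).trans (by linarith)
  rcases hF c₁ h₁ c hc with a1 | a1 <;> rcases hcc with a2 | a2
  · exact (main a1 a2).elim
  · exact (inc h₁ hc h₁ hc hfar' (by linarith) (by linarith)).elim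
  · exact (inc hc h₁ h₁ hc hfar' (by linarith) (by linarith)).elim
  · exact ⟨a1, a2⟩

theorem Hyp.pdx_near (hφ : Hyp M φ) (hM : 10 ≤ M) {z z' : ℝ × ℝ}
    (hz : z ∈ interior sq2) (hz' : z' ∈ interior sq2) :
    |pdx φ z' - pdx φ z - (z'.2 - z.2)| ≤ 1 / 1000 * l1 z z' := by
  have h := hφ.swap.lev_near hM (a := 0) (by norm_num) (swap_mem_U hz) (swap_mem_U hz')
  simp only [lev, zero_mul, sub_zero, pdy_comp_swap, Function.comp_apply, Prod.swap_swap,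
    Prod.fst_swap, Prod.snd_swap] at h
  rw [l1, add_comm]; exact h

/-- Changing the base point changes t² by the change of A times that of φ_x. Since t² is small the
displacement is mainly vertical, so φ_x changes by at least 2D/5, and 100δ/(2D/5) = 250δ/D is less
than s by `sep`. -/
theorem Hyp.coefA_sub_le (hφ : Hyp M φ) (hM : 10 ≤ M) (H : Scales M C h δ s b w D)
    {p c : ℝ × ℝ} (hp : p ∈ interior sq2) (hc : c ∈ interior sq2) (hfar : D / 2 ≤ l1 p c)
    (h1 : |t2 φ p p c| < 50 * δ) (h2 : |t2 φ c p c| < 50 * δ) :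
    |coefA φ c - coefA φ p| ≤ s := by
  have h3 := hφ.t2_near hM hp hp hc
  have h4 := hφ.pdx_near hM hp hc
  have h5 := abs_sub (t2 φ p p c) (t2 φ p p c - (c.1 - p.1))
  rw [sub_sub_cancel] at h5
  have h6 := abs_sub (pdx φ c - pdx φ p) (pdx φ c - pdx φ p - (c.2 - p.2))
  rw [sub_sub_cancel] at h6
  have h7 : 2 / 5 * D ≤ |pdx φ c - pdx φ p| := by
    have := H.far
    have := H.δ_pos
    simp only [l1] at *
    linarith
  have e : (coefA φ c - coefA φ p) * (pdx φ c - pdx φ p) = t2 φ p p c - t2 φ c p c := by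
    simp only [t2]; ring
  have h8 : |coefA φ c - coefA φ p| * |pdx φ c - pdx φ p| ≤ 100 * δ := by
    rw [← abs_mul, e]
    exact (abs_sub _ _).trans (by linarith)
  have hD : 0 < D := by linarith [H.far, H.δ_pos]
  by_contra! hcon
  have h9 : s * (2 / 5 * D) ≤ |coefA φ c - coefA φ p| * |pdx φ c - pdx φ p| :=
    mul_le_mul hcon.le h7 (by positivity) (abs_nonneg _)
  have := H.sep
  have := H.δ_pos
  linarith

theorem cap_subset_near {K μ : ℝ} {c z u : ℝ × ℝ} (hz : z ∈ cap K μ c) (hu : u ∈ cap K μ c) :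
    |u.1 - z.1| + |u.2 - z.2| ≤ 2 * (√μ * K⁻¹) := by
  have h1 := abs_sub (u.1 - c.1) (z.1 - c.1)
  have h2 := abs_sub (u.2 - c.2) (z.2 - c.2)
  rw [sub_sub_sub_cancel_right] at h1 h2
  linarith [hz.1.1, hz.1.2, hu.1.1, hu.1.2]

theorem center_mem_U {K μ : ℝ} (hδ : √μ * K⁻¹ ≤ 1) {c : ℝ × ℝ} (hc : (cap K μ c).Nonempty) :
    c ∈ interior sq2 := by
  obtain ⟨z, hz⟩ := hc
  have h1 := mem_sq.1 hz.2
  have h2 := abs_sub z.1 (z.1 - c.1)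
  have h3 := abs_sub z.2 (z.2 - c.2)
  rw [sub_sub_cancel] at h2 h3
  rw [mem_U]
  constructor <;> linarith [hz.1.1, hz.1.2]

theorem Hyp.mem_levelSet (hφ : Hyp M φ) (hM : 10 ≤ M) {K μ : ℝ}
    (H : Scales M C h (√μ * K⁻¹) s b w D) {p c z : ℝ × ℝ} (hp : p ∈ interior sq2)
    (hc : c ∈ interior sq2) (hz : z ∈ cap K μ c) (h1 : |t2 φ p p c| < 50 * (√μ * K⁻¹))
    (hA : |coefA φ c - coefA φ p| ≤ s) :
    z ∈ levelSet φ (coefA φ p) (lev φ (coefA φ p) p) (√μ * K⁻¹) s := by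
  have hzU := sq_subset_U hz.2
  have ha := hφ.abs_coefA_le hM hp
  have hδ := H.δ_pos
  have hs := H.δ_le_s
  set δ := √μ * K⁻¹ with hδdef
  have hx : |z.1 - c.1| ≤ δ / 2 := hz.1.1
  have hy : |z.2 - c.2| ≤ δ / 2 := hz.1.2
  refine ⟨hz.2, ?_, ?_⟩
  · have h2 := hφ.lev_near hM ha hc hzU
    rw [t2_eq] at h1
    have h1' := abs_lt.1 h1
    have h2' := abs_le.1 h2
    have hx' := abs_le.1 hx
    rw [abs_le]
    constructor <;> linarith [h1'.1, h1'.2, h2'.1, h2'.2, hx'.1, hx'.2]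
  · have h2 := hφ.lip_hessDir hM ha hc hzU
    have h3 := (hφ.abs_hessDir hM ha hc).2
    have h4 := abs_add_le (hessDir φ (coefA φ p) z - hessDir φ (coefA φ p) c)
      (hessDir φ (coefA φ p) c)
    rw [sub_add_cancel] at h4
    linarith

/-- Every centre is at distance at least D/2 from c₁ or from c₂, so two level curves, one through
each, serve all caps. One point of a cap in the level set is enough, because the cap lies in the
s-neighbourhood of that point. -/
theorem Hyp.vertical_cover (hφ : Hyp M φ) (hM : 10 ≤ M) {K μ : ℝ}
    (H : Scales M C h (√μ * K⁻¹) s b w D) {a₀ : ℝ} {𝓛 : Set (Set (ℝ × ℝ))}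
    (h𝓛 : IsStripFamily φ a₀ (C * s) w s b 𝓛) {F : Set (ℝ × ℝ)}
    (hne : ∀ c ∈ F, (cap K μ c).Nonempty)
    (hF : ∀ p ∈ F, ∀ q ∈ F,
      |t1 φ p p q| < 50 * (√μ * K⁻¹) ∨ |t2 φ p p q| < 50 * (√μ * K⁻¹))
    {c₁ c₂ : ℝ × ℝ} (h₁ : c₁ ∈ F) (h₂ : c₂ ∈ F) (hfar : D ≤ l1 c₁ c₂)
    (ht₁ : |t2 φ c₁ c₁ c₂| < 50 * (√μ * K⁻¹)) (ht₂ : |t2 φ c₂ c₁ c₂| < 50 * (√μ * K⁻¹)) :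
    CapCover K μ 𝓛 F (2 * coverCount M h) := by
  have hδ := H.δ_pos
  have hFU : F ⊆ interior sq2 := fun c hc =>
    center_mem_U (by linarith [H.δ_le_h, H.h_le]) (hne c hc)
  have hcov : ∀ i < 2, PtCover 𝓛 s (levelSet φ (coefA φ (if i = 0 then c₁ else c₂))
      (lev φ (coefA φ (if i = 0 then c₁ else c₂)) (if i = 0 then c₁ else c₂)) (√μ * K⁻¹) s)
      (coverCount M h) := fun i _ => by
    refine hφ.levelSet_cover hM H (hφ.abs_coefA_le hM ?_) _ h𝓛
    split_ifs
    exacts [hFU h₁, hFU h₂]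
  obtain ⟨𝓛₀, hsub, hfin, hcard, hc⟩ := PtCover.biUnion hcov
  refine ⟨𝓛₀, hsub, hfin, hcard, fun c hcF => ?_⟩
  obtain ⟨z, hz⟩ := hne c hcF
  have hmem : ∃ i < 2, z ∈ levelSet φ (coefA φ (if i = 0 then c₁ else c₂))
      (lev φ (coefA φ (if i = 0 then c₁ else c₂)) (if i = 0 then c₁ else c₂)) (√μ * K⁻¹) s := by
    have htri := l1_triangle c₁ c c₂
    rw [l1_comm c c₂] at htri
    have hD := H.far
    rcases le_or_gt (D / 2) (l1 c₁ c) with hd | hd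
    · refine ⟨0, by norm_num, ?_⟩
      obtain ⟨k1, k2⟩ := hφ.t2_of_far hM hFU hδ hF h₁ h₂ hcF (by linarith) (by linarith) ht₁ ht₂
      exact hφ.mem_levelSet hM H (hFU h₁) (hFU hcF) hz k1
        (hφ.coefA_sub_le hM H (hFU h₁) (hFU hcF) hd k1 k2)
    · refine ⟨1, by norm_num, ?_⟩
      have hd' : D / 2 ≤ l1 c₂ c := by linarith
      obtain ⟨k1, k2⟩ := hφ.t2_of_far hM hFU hδ hF h₂ h₁ hcF (by rw [l1_comm]; linarith)
        (by linarith) (by rwa [abs_t2_comm]) (by rwa [abs_t2_comm])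
      exact hφ.mem_levelSet hM H (hFU h₂) (hFU hcF) hz k1
        (hφ.coefA_sub_le hM H (hFU h₂) (hFU hcF) hd' k1 k2)
  obtain ⟨L, hL, hu⟩ := hc z hmem
  exact ⟨L, hL, fun u hu' => hu u ((cap_subset_near hz hu').trans (by linarith [H.δ_le_s]))⟩

theorem swap_mem_cap {K μ : ℝ} {c z : ℝ × ℝ} (hz : z ∈ cap K μ c) : z.swap ∈ cap K μ c.swap :=
  ⟨⟨hz.1.2, hz.1.1⟩, hz.2.2, hz.2.1⟩

theorem CapCover.swap {K μ : ℝ} {𝓛 : Set (Set (ℝ × ℝ))} {F : Set (ℝ × ℝ)} {n : ℕ}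
    (h : CapCover K μ 𝓛 (Prod.swap '' F) n) :
    CapCover K μ ((fun L => Prod.swap '' L) '' 𝓛) F n := by
  obtain ⟨𝓛₀, hsub, hfin, hcard, hc⟩ := h
  refine ⟨(fun L => Prod.swap '' L) '' 𝓛₀, image_mono hsub, hfin.image _,
    (ncard_image_le hfin).trans hcard, fun c hcF => ?_⟩
  obtain ⟨L, hL, hcL⟩ := hc _ (mem_image_of_mem _ hcF)
  exact ⟨_, mem_image_of_mem _ hL, fun u hu => ⟨u.swap, hcL (swap_mem_cap hu), u.swap_swap⟩⟩

theorem CapCover.mono {K μ : ℝ} {𝓛 𝓛' : Set (Set (ℝ × ℝ))} {F : Set (ℝ × ℝ)} {n n' : ℕ}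
    (h : CapCover K μ 𝓛 F n) (h𝓛 : 𝓛 ⊆ 𝓛') (hn : n ≤ n') : CapCover K μ 𝓛' F n' := by
  obtain ⟨𝓛₀, hsub, hfin, hcard, hc⟩ := h
  exact ⟨𝓛₀, hsub.trans h𝓛, hfin, hcard.trans hn, hc⟩

theorem Hyp.horizontal_cover (hφ : Hyp M φ) (hM : 10 ≤ M) {K μ : ℝ}
    (H : Scales M C h (√μ * K⁻¹) s b w D) {a₀ : ℝ} {𝓛 : Set (Set (ℝ × ℝ))}
    (h𝓛 : IsStripFamily (φ ∘ Prod.swap) a₀ (C * s) w s b 𝓛) {F : Set (ℝ × ℝ)}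
    (hne : ∀ c ∈ F, (cap K μ c).Nonempty)
    (hF : ∀ p ∈ F, ∀ q ∈ F,
      |t1 φ p p q| < 50 * (√μ * K⁻¹) ∨ |t2 φ p p q| < 50 * (√μ * K⁻¹))
    {c₁ c₂ : ℝ × ℝ} (h₁ : c₁ ∈ F) (h₂ : c₂ ∈ F) (hfar : D ≤ l1 c₁ c₂)
    (ht₁ : |t1 φ c₁ c₁ c₂| < 50 * (√μ * K⁻¹)) (ht₂ : |t1 φ c₂ c₁ c₂| < 50 * (√μ * K⁻¹)) :
    CapCover K μ ((fun L => Prod.swap '' L) '' 𝓛) F (2 * coverCount M h) := by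
  have hFU : F ⊆ interior sq2 := fun c hc =>
    center_mem_U (by linarith [H.δ_le_h, H.h_le, H.δ_pos]) (hne c hc)
  refine CapCover.swap (hφ.swap.vertical_cover hM H h𝓛 ?_ ?_ (mem_image_of_mem _ h₁)
    (mem_image_of_mem _ h₂) ?_ ?_ ?_)
  · rintro _ ⟨c, hc, rfl⟩
    obtain ⟨z, hz⟩ := hne c hc
    exact ⟨_, swap_mem_cap hz⟩
  · rintro _ ⟨p, hp, rfl⟩ _ ⟨q, hq, rfl⟩
    rw [← hφ.t1_eq_t2_swap hM (hFU hp), ← hφ.t2_eq_t1_swap hM (hFU hp)]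
    exact (hF p hp q hq).symm
  · simp only [l1, Prod.fst_swap, Prod.snd_swap] at hfar ⊢
    linarith
  · rwa [← hφ.t1_eq_t2_swap hM (hFU h₁)]
  · rwa [← hφ.t1_eq_t2_swap hM (hFU h₂)]

/-- Caps close to each other lie in one of the large squares. -/
theorem exists_largeCap {K μ d : ℝ} {c₀ : ℝ × ℝ} (hδ : 0 < √μ * K⁻¹) (hd : 8 * (√μ * K⁻¹) ≤ d)
    {F : Set (ℝ × ℝ)} {c : ℝ × ℝ} (hc : c ∈ F) (hne : (cap K μ c).Nonempty)
    (hF : ∀ q ∈ F, l1 c q ≤ d / 8) : CapCover K μ (largeCaps c₀ d) F 1 := by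
  have hd0 : 0 < d := by linarith
  have hround : ∀ x x₀ : ℝ, |x - (x₀ + round ((x - x₀) / (d / 2)) * (d / 2))| ≤ d / 4 := by
    intro x x₀
    have h1 := abs_sub_round ((x - x₀) / (d / 2))
    have e : x - (x₀ + round ((x - x₀) / (d / 2)) * (d / 2))
        = ((x - x₀) / (d / 2) - round ((x - x₀) / (d / 2))) * (d / 2) := by
      field_simp; ring
    rw [e, abs_mul, abs_of_pos (by linarith : 0 < d / 2)]
    nlinarith
  set e : ℝ × ℝ := (c₀.1 + round ((c.1 - c₀.1) / (d / 2)) * (d / 2),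
    c₀.2 + round ((c.2 - c₀.2) / (d / 2)) * (d / 2)) with he
  have hsub : ∀ q ∈ F, cap K μ q ⊆ square e d := by
    intro q hq u hu
    have h1 := hF q hq
    rw [l1] at h1
    constructor
    · have h2 : |c.1 - e.1| ≤ d / 4 := hround c.1 c₀.1
      have h3 := abs_add_le (u.1 - q.1) (q.1 - c.1)
      have h4 := abs_add_le (u.1 - c.1) (c.1 - e.1)
      rw [sub_add_sub_cancel] at h3 h4
      have := hu.1.1
      have := abs_nonneg (q.2 - c.2)
      linarith
    · have h2 : |c.2 - e.2| ≤ d / 4 := hround c.2 c₀.2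
      have h3 := abs_add_le (u.2 - q.2) (q.2 - c.2)
      have h4 := abs_add_le (u.2 - c.2) (c.2 - e.2)
      rw [sub_add_sub_cancel] at h3 h4
      have := hu.1.2
      have := abs_nonneg (q.1 - c.1)
      linarith
  obtain ⟨z, hz⟩ := hne
  refine ⟨{square e d}, ?_, finite_singleton _, by simp, fun q hq => ⟨_, rfl, hsub q hq⟩⟩
  rw [singleton_subset_iff]
  exact ⟨⟨z, hsub c hc hz, hz.2⟩, _, _, rfl⟩

theorem lt_or_lt_of_not_stronglySeparated {K μ : ℝ} (hδ : 0 < √μ * K⁻¹) {p q : ℝ × ℝ}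
    (h : ¬ StronglySeparated φ K μ p q) :
    (|t1 φ p p q| < 50 * (√μ * K⁻¹) ∨ |t2 φ p p q| < 50 * (√μ * K⁻¹)) ∧
      (|t1 φ q p q| < 50 * (√μ * K⁻¹) ∨ |t2 φ q p q| < 50 * (√μ * K⁻¹)) := by
  -- Equal centres are not strongly separated by definition; there t¹ vanishes.
  by_cases hpq : p = q
  · subst hpq
    have : |t1 φ p p p| < 50 * (√μ * K⁻¹) := by
      have e : t1 φ p p p = 0 := by simp [t1]
      rw [e, abs_zero]; linarith
    exact ⟨Or.inl this, Or.inl this⟩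
  · have h' := not_le.1 fun h' => h ⟨hpq, h'⟩
    rw [max_lt_iff, min_lt_iff, min_lt_iff] at h'
    exact h'

theorem Hyp.family_cover (hφ : Hyp M φ) (hM : 10 ≤ M) {K μ d : ℝ}
    (H : Scales M C h (√μ * K⁻¹) s b w (d / 8)) {a₀ b₀ : ℝ} {c₀ : ℝ × ℝ}
    {𝓛₁ 𝓛₂ : Set (Set (ℝ × ℝ))}
    (h𝓛₁ : IsStripFamily φ a₀ (C * s) w s b 𝓛₁)
    (h𝓛₂ : IsStripFamily (φ ∘ Prod.swap) b₀ (C * s) w s b 𝓛₂) {F : Set (ℝ × ℝ)}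
    (hne : ∀ c ∈ F, (cap K μ c).Nonempty)
    (hF : ∀ c₁ ∈ F, ∀ c₂ ∈ F, ¬ StronglySeparated φ K μ c₁ c₂) :
    CapCover K μ (𝓛₁ ∪ (fun L => Prod.swap '' L) '' 𝓛₂ ∪ largeCaps c₀ d) F
      (2 * coverCount M h) := by
  have hδ := H.δ_pos
  have hcount : 1 ≤ 2 * coverCount M h := by
    have : 0 < coverCount M h := by rw [coverCount]; positivity
    omega
  have hpair := fun p hp q hq => lt_or_lt_of_not_stronglySeparated hδ (hF p hp q hq)
  rcases F.eq_empty_or_nonempty with rfl | ⟨c, hc⟩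
  · exact ⟨∅, empty_subset _, finite_empty, by simp, by simp⟩
  by_cases hsmall : ∀ q ∈ F, l1 c q ≤ d / 8
  · exact (exists_largeCap hδ (by linarith [H.far]) hc (hne c hc) hsmall).mono
      subset_union_right hcount
  · push Not at hsmall
    obtain ⟨q, hq, hfar⟩ := hsmall
    have hFU : F ⊆ interior sq2 := fun c hc =>
      center_mem_U (by linarith [H.δ_le_h, H.h_le]) (hne c hc)
    -- The mixed cases, with t¹ small at one base point and t² at the other, would force distance at
    -- most 150δ, less than D.
    have hex : ∀ {p p'}, p ∈ F → p' ∈ F → |t1 φ p c q| < 50 * (√μ * K⁻¹) →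
        |t2 φ p' c q| < 50 * (√μ * K⁻¹) → False := fun hp hp' h1 h2 => by
      have := hφ.l1_le_of_t1_t2 hM (hFU hp) (hFU hp') (hFU hc) (hFU hq) h1.le h2.le
      linarith [H.far]
    obtain ⟨k1, k2⟩ := hpair c hc q hq
    rcases k1 with k1 | k1 <;> rcases k2 with k2 | k2
    · exact (hφ.horizontal_cover hM H h𝓛₂ hne (fun p hp q hq => (hpair p hp q hq).1) hc hq hfar.le
        k1 k2).mono (subset_union_right.trans subset_union_left) le_rfl
    · exact (hex hc hq k1 k2).elim
    · exact (hex hq hc k2 k1).elim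
    · exact (hφ.vertical_cover hM H h𝓛₁ hne (fun p hp q hq => (hpair p hp q hq).1) hc hq hfar.le
        k1 k2).mono (subset_union_left.trans subset_union_left) le_rfl

/-! ### Choice of the parameters -/

/-- Here x = K^{-1/4}, y = K^{-ε'} and m = √μ, so that all scales become monomials. The condition
`sep` rests on D s ≥ 20000 m δ with m ≥ 1. In `taylor`, one power of x in x⁵ is spent on the
constant 5M·2^M, leaving x⁴ ≤ δ. -/
theorem Scales.of_powers {M : ℕ} {C C' C₃ m x y : ℝ} (hM : 10 ≤ M) (hx0 : 0 < x)
    (hx : 1000 * x ≤ 1) (hy0 : 0 < y) (hy : 100 * y ≤ 1) (hxy : x ≤ y ^ 2) (hm : 1 ≤ m)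
    (hmx : m * x ≤ 1) (hpow : (y ^ 2) ^ (M - 2) ≤ x ^ 5) (hMx : 5 * M * 2 ^ M * x ≤ 1)
    (hC : 16 < C) (hCx : C * x ^ 2 ≤ 1) (hC' : C + 4 ≤ C') (hC₃ : 160000 ≤ C₃) :
    Scales M C (y ^ 2) (m * x ^ 4) (m * x ^ 3) (y / 2) (C' * (m * x ^ 3))
      (C₃ * (m * x) / 8) := by
  have hs : m * x ^ 3 ≤ x ^ 2 := by
    calc m * x ^ 3 = m * x * x ^ 2 := by ring
      _ ≤ 1 * x ^ 2 := by gcongr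
      _ = x ^ 2 := one_mul _
  have hx1 : x ≤ 1 := by linarith
  have hx2 : x ^ 2 ≤ x := by nlinarith
  have hδs : m * x ^ 4 = m * x ^ 3 * x := by ring
  have hs0 : 0 < m * x ^ 3 := by positivity
  have hδ1 : x ^ 4 ≤ m * x ^ 4 := le_mul_of_one_le_left (by positivity) hm
  refine ⟨by positivity, by nlinarith, by nlinarith, ?_, ?_, ?_, hC, ?_, ?_, ?_, ?_, ?_⟩
  · have h1 : m * x ^ 4 ≤ x ^ 2 * x := by rw [hδs]; gcongr
    nlinarith
  · have h2 : (2 * y ^ 2) ^ (M - 2) ≤ 2 ^ M * x ^ 5 := by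
      rw [mul_pow]
      have : (2 : ℝ) ^ (M - 2) ≤ 2 ^ M := pow_le_pow_right₀ one_le_two (Nat.sub_le _ _)
      gcongr
    calc 5 * (M * (2 * y ^ 2) ^ (M - 2)) ≤ 5 * (M * (2 ^ M * x ^ 5)) := by gcongr
      _ = (5 * M * 2 ^ M * x) * x ^ 4 := by ring
      _ ≤ 1 * x ^ 4 := by gcongr
      _ ≤ _ := by rwa [one_mul]
  · have h1 : (y ^ 2) ^ M ≤ (y ^ 2) ^ (M - 2) :=
      pow_le_pow_of_le_one (by positivity) (by nlinarith) (Nat.sub_le _ _)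
    have h2 : x ^ 5 ≤ x ^ 4 := pow_le_pow_of_le_one hx0.le hx1 (by norm_num)
    linarith
  · calc C * (m * x ^ 3) ≤ C * x ^ 2 := by gcongr
      _ ≤ 1 := hCx
  · gcongr
  · nlinarith
  · have h1 : m * x ^ 4 ≤ m * x := by
      have : x ^ 4 ≤ x := by simpa using pow_le_pow_of_le_one hx0.le hx1 (show 1 ≤ 4 by norm_num)
      gcongr
    have h2 : 160000 * (m * x) ≤ C₃ * (m * x) := by gcongr
    linarith
  · have h2 : 160000 * (m * x) ≤ C₃ * (m * x) := by gcongr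
    have h3 : 20000 * (m * x) * (m * x ^ 3) ≤ C₃ * (m * x) / 8 * (m * x ^ 3) := by
      have : 20000 * (m * x) ≤ C₃ * (m * x) / 8 := by linarith
      gcongr
    have h4 : 20000 * (m * x) * (m * x ^ 3) = 20000 * (m * (m * x ^ 4)) := by ring
    have h5 : m * x ^ 4 ≤ m * (m * x ^ 4) := le_mul_of_one_le_left (by positivity) hm
    have : 0 ≤ m * x ^ 4 := by positivity
    linarith

/-- How large `K` has to be for the given `C`, `ε'` and order of smoothness `M`. -/
structure LargeParameter (M : ℕ) (C ε' K : ℝ) : Prop where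
  one_le : 1 ≤ K
  quarter : 1000 + 5 * M * 2 ^ M + C ≤ K ^ (1 / 4 : ℝ)
  small : 100 + 18 * ((labelBound M : ℝ) + 1) ≤ K ^ ε'

theorem eventually_largeParameter (M : ℕ) (C : ℝ) {ε' : ℝ} (hε' : 0 < ε') :
    ∀ᶠ K : ℝ in Filter.atTop, LargeParameter M C ε' K := by
  filter_upwards [Filter.eventually_ge_atTop 1,
    (tendsto_rpow_atTop (show (0 : ℝ) < 1 / 4 by norm_num)).eventually_ge_atTop
      (1000 + 5 * M * 2 ^ M + C),
    (tendsto_rpow_atTop hε').eventually_ge_atTop (100 + 18 * ((labelBound M : ℝ) + 1))]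
    with K h1 h2 h3 using ⟨h1, h2, h3⟩

theorem LargeParameter.scales {M : ℕ} {C C' C₃ ε' K μ : ℝ} (hK : LargeParameter M C ε' K)
    (hε' : ε' ≤ 1 / 100) (hM : 3 / 4 ≤ ε' * M) (hμ : 1 ≤ μ) (hμK : √μ ≤ K ^ (1 / 4 : ℝ))
    (hM10 : 10 ≤ M) (hC : 16 < C) (hC' : C + 4 ≤ C') (hC₃ : 160000 ≤ C₃) :
    Scales M C (K ^ (-(2 * ε'))) (√μ * K⁻¹) (√μ * K ^ (-(3 / 4) : ℝ)) (K ^ (-ε') / 2)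
      (C' * (√μ * K ^ (-(3 / 4) : ℝ))) (C₃ * (√μ * K ^ (-(1 / 4) : ℝ)) / 8) := by
  have hK0 : 0 < K := by linarith [hK.one_le]
  have hpow : ∀ (u : ℝ) (n : ℕ), K ^ (u * n) = (K ^ u) ^ n := fun u n => by
    rw [Real.rpow_mul hK0.le, Real.rpow_natCast]
  have e1 : K ^ (-(2 * ε')) = (K ^ (-ε')) ^ 2 := by rw [← hpow]; congr 1; push_cast; ring
  have e2 : K⁻¹ = (K ^ (-(1 / 4) : ℝ)) ^ 4 := by
    rw [← hpow, ← Real.rpow_neg_one]; congr 1; push_cast; ring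
  have e3 : K ^ (-(3 / 4) : ℝ) = (K ^ (-(1 / 4) : ℝ)) ^ 3 := by
    rw [← hpow]; congr 1; push_cast; ring
  have hX : K ^ (-(1 / 4) : ℝ) = (K ^ (1 / 4 : ℝ))⁻¹ := Real.rpow_neg hK0.le _
  have hY : K ^ (-ε') = (K ^ ε')⁻¹ := Real.rpow_neg hK0.le _
  have hXpos : 0 < K ^ (1 / 4 : ℝ) := by positivity
  have hYpos : 0 < K ^ ε' := by positivity
  have hMpos : (0 : ℝ) ≤ 5 * M * 2 ^ M := by positivity
  have hLpos : (0 : ℝ) ≤ 18 * ((labelBound M : ℝ) + 1) := by positivity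
  have hq := hK.quarter
  have hsm := hK.small
  have inv_le : ∀ {c X : ℝ}, 0 < X → c ≤ X → c * X⁻¹ ≤ 1 := fun hX0 hc => by
    rw [← div_eq_mul_inv, div_le_one hX0]; exact hc
  have hCX : C * (K ^ (-(1 / 4) : ℝ)) ≤ 1 := by rw [hX]; exact inv_le hXpos (by linarith)
  rw [e1, e2, e3]
  refine Scales.of_powers hM10 (by positivity) ?_ (by positivity) ?_ ?_ ?_ ?_ ?_ ?_ hC ?_ hC' hC₃
  · rw [hX]; exact inv_le hXpos (by linarith)
  · rw [hY]; exact inv_le hYpos (by linarith)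
  · rw [← e1]; exact Real.rpow_le_rpow_of_exponent_le hK.one_le (by linarith)
  · exact Real.one_le_sqrt.2 hμ
  · rw [hX]; exact inv_le hXpos hμK
  · rw [← e1, ← hpow, ← hpow]
    -- The exponents compare because 2ε'(M − 2) ≥ 3/2 − 4ε' ≥ 5/4.
    refine Real.rpow_le_rpow_of_exponent_le hK.one_le ?_
    rw [Nat.cast_sub (by omega)]
    push_cast
    linarith
  · rw [hX]; exact inv_le hXpos (by linarith)
  · have h1 : K ^ (-(1 / 4) : ℝ) ≤ 1 := Real.rpow_le_one_of_one_le_of_nonpos hK.one_le (by norm_num)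
    have h0 : 0 < K ^ (-(1 / 4) : ℝ) := by positivity
    nlinarith

/-- The slabs contribute 2/h = 2K^{2ε'}; the constant 18(`labelBound` + 1) is absorbed by the
remaining K^{ε'}. -/
theorem LargeParameter.coverCount_le {M : ℕ} {C ε' K : ℝ} (hK : LargeParameter M C ε' K) :
    ((2 * coverCount M (K ^ (-(2 * ε'))) : ℕ) : ℝ) ≤ K ^ (3 * ε') := by
  have hK0 : 0 < K := by linarith [hK.one_le]
  have hsm := hK.small
  have hL : (0 : ℝ) ≤ (labelBound M : ℝ) := by positivity
  set Y := K ^ ε' with hYdef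
  have e2 : K ^ (2 * ε') = Y ^ 2 := by
    rw [hYdef, ← Real.rpow_natCast, ← Real.rpow_mul hK0.le]; congr 1; push_cast; ring
  have e3 : K ^ (3 * ε') = Y ^ 3 := by
    rw [hYdef, ← Real.rpow_natCast, ← Real.rpow_mul hK0.le]; congr 1; push_cast; ring
  have hfl : (⌊2 / K ^ (-(2 * ε'))⌋₊ : ℝ) ≤ 2 * Y ^ 2 := by
    refine (Nat.floor_le (by positivity)).trans_eq ?_
    rw [Real.rpow_neg hK0.le, e2, div_inv_eq_mul]
  rw [coverCount, e3]
  push_cast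
  have hY1 : 1 ≤ Y ^ 2 := by nlinarith
  calc 2 * (((⌊2 / K ^ (-(2 * ε'))⌋₊ : ℝ) + 1) * (((labelBound M : ℝ) + 1) * 3))
      ≤ 2 * ((3 * Y ^ 2) * (((labelBound M : ℝ) + 1) * 3)) := by
        gcongr; linarith
    _ = Y ^ 2 * (18 * ((labelBound M : ℝ) + 1)) := by ring
    _ ≤ Y ^ 2 * Y := by gcongr; linarith
    _ = Y ^ 3 := by ring

end HypSurface

end

/-! ### The Geometric Lemma -/

theorem lemma4p3 :
    ∃ C₀ : ℝ, ∀ C ≥ C₀, ∀ C₃ ≥ C₀, ∃ C₀' : ℝ, ∀ C' ≥ C₀',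
    ∀ N : ℕ, 1 ≤ N → ∀ ε ε' : ℝ, 0 < ε → ε < (10 : ℝ)⁻¹ ^ 10 → 10 * N * ε' = ε ^ 8 →
    ∃ K₁ : ℝ, 1 ≤ K₁ ∧
    ∀ M : ℕ, 3 / (4 * (M : ℝ)) ≤ ε' → ε' ≤ 3 / (2 * (M : ℝ)) →
    ∀ K ≥ K₁, ∀ μ : ℝ, 1 ≤ μ → μ ≤ K ^ (ε / 2) →
    ∀ φ : ℝ × ℝ → ℝ, HypSurface.Hyp M φ →
    ∀ 𝓛 : Set (Set (ℝ × ℝ)), HypSurface.IsAdaptedFamily φ C C' C₃ ε' K μ 𝓛 →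
    ∀ F : Set (ℝ × ℝ), (∀ c ∈ F, (HypSurface.cap K μ c).Nonempty) →
      (∀ c₁ ∈ F, ∀ c₂ ∈ F, ¬ HypSurface.StronglySeparated φ K μ c₁ c₂) →
      ∃ 𝓛₀ ⊆ 𝓛, 𝓛₀.Finite ∧ (𝓛₀.ncard : ℝ) ≤ K ^ (3 * ε') ∧
        ∀ c ∈ F, ∃ L ∈ 𝓛₀, HypSurface.cap K μ c ⊆ L := by
  -- 160000 = 8 · 20000 makes D = d/8 at least 20000 √μ K^{-1/4}; C + 4 is the width needed in
  -- `IsStripFamily.exists_cover`.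
  refine ⟨160000, fun C hC C₃ hC₃ => ⟨C + 4, fun C' hC' N hN ε ε' hε0 hε hNε => ?_⟩⟩
  have hN1 : (1 : ℝ) ≤ N := by exact_mod_cast hN
  have hε1 : ε ≤ 1 / 100 := hε.le.trans (by norm_num)
  have hε8 : 0 < ε ^ 8 := by positivity
  have hε'0 : 0 < ε' := by
    by_contra! hcon
    nlinarith
  have hε' : ε' ≤ 1 / 100 := by
    have h1 : ε ^ 8 ≤ ε := by
      simpa using pow_le_pow_of_le_one hε0.le (by linarith) (show 1 ≤ 8 by norm_num)
    nlinarith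
  -- The threshold for K depends on M, but only the finitely many M ≤ 3/(2ε') occur, so one K₁
  -- serves them all.
  have hev : ∀ᶠ K : ℝ in Filter.atTop, ∀ M ∈ Finset.range (⌈3 / (2 * ε')⌉₊ + 1),
      HypSurface.LargeParameter M C ε' K :=
    (Filter.eventually_all_finset _).2 fun M _ =>
      HypSurface.eventually_largeParameter M C hε'0
  obtain ⟨K₀, hK₀⟩ := Filter.eventually_atTop.1 hev
  refine ⟨max K₀ 1, le_max_right _ _, fun M hM1 hM2 K hK μ hμ hμK φ hφ 𝓛 h𝓛 F hne hF => ?_⟩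
  have hM0 : (0 : ℝ) < M := by
    rcases Nat.eq_zero_or_pos M with rfl | h
    -- For M = 0 the quotient 3/(2M) is 0 by convention, which contradicts ε' > 0.
    · simp at hM2; linarith
    · exact_mod_cast h
  have hMle : (M : ℝ) ≤ 3 / (2 * ε') := by
    rw [le_div_iff₀ (by positivity)] at hM2 ⊢
    linarith
  have hMge : 3 / 4 ≤ ε' * M := by
    rw [div_le_iff₀ (by positivity)] at hM1
    linarith
  have hM10 : 10 ≤ M := by
    have : (10 : ℝ) ≤ M := by nlinarith
    exact_mod_cast this
  have hL := hK₀ K ((le_max_left _ _).trans hK) M (Finset.mem_range.2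
    (Nat.lt_succ_of_le (by exact_mod_cast hMle.trans (Nat.le_ceil _))))
  have hsqrt : √μ ≤ K ^ (1 / 4 : ℝ) := by
    rw [Real.sqrt_eq_rpow]
    have hK0 : 0 ≤ K := by linarith [hL.one_le]
    calc μ ^ (1 / 2 : ℝ) ≤ (K ^ (ε / 2)) ^ (1 / 2 : ℝ) := by gcongr
      _ = K ^ (ε / 2 * (1 / 2)) := (Real.rpow_mul hK0 _ _).symm
      _ ≤ K ^ (1 / 4 : ℝ) := Real.rpow_le_rpow_of_exponent_le hL.one_le (by linarith)
  obtain ⟨a₀, b₀, c₀, 𝓛₁, 𝓛₂, h₁, h₂, rfl⟩ := h𝓛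
  have hS := hL.scales hε' hMge hμ hsqrt hM10 (lt_of_lt_of_le (by norm_num) hC) hC' hC₃
  obtain ⟨𝓛₀, hsub, hfin, hcard, hc⟩ := hφ.family_cover hM10 hS (c₀ := c₀) h₁ h₂ hne hF
  exact ⟨𝓛₀, hsub, hfin, (Nat.cast_le.2 hcard).trans (hL.coverCount_le), hc⟩
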